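/- Let $X$ be a separable real Hilbert space with a Borel probability measure $\nu$, and let $R\in\mathcal L(X)$. Let $C^1_b(X)$ be the space of bounded, continuously Fréchet differentiable functions $\varphi:X\to\mathbb R$ with bounded gradient, and assume that for every $z\in X$ there is $v_z\in\bigcap_{1<p<\infty}L^p(X,\nu)$ with $$\int_X\langle R\nabla\varphi,z\rangle\,d\nu=\int_X v_z\,\varphi\,d\nu\qquad\text{for all }\varphi\in C^1_b(X).$$ For $p\in(1,\infty)$ let $M_p$ be the closure in $L^p(X,\nu)$ of the operator $R\nabla: C^1_b(X)\to L^p(X,\nu;X)$ and let $M_p^*:D(M_p^*)\subset L^{p'}(X,\nu;X)\to L^{p'}(X,\nu)$, $p'=p/(p-1)$, be its adjoint; for $F\in\bigcap_{1<p<\infty}D(M_p^*)$ write $M^*F$ for the common value of $M_p^*F$. Let $\widetilde C^1_b(X,X)$ be the set of vector fields $F=\sum_{i=1}^n f_iz_i$ with $n\in\mathbb N$, $f_i\in C^1_b(X)$, $z_i\in X$ (they belong to $D(M_p^*)$ for all $p\in(1,\infty)$), and for $u\in L^p(X,\nu)$, $p>1$, set $$V(u)=\sup\Big\{\int_X u\,M^*F\,d\nu:\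 F\in\widetilde C^1_b(X,X),\ \|F(x)\|\le 1\ \ \forall x\in X\Big\}.$$ A function $u\in L^1(X,\nu)$ with $uv_z\in L^1(X,\nu)$ for every $z\in X$ belongs to $BV(X,\nu)$ if there is a countably additive Borel measure $m:\mathcal B(X)\to X$ with finite total variation, $|m|(X)<\infty$, such that, with $m_z(B)=\langle m(B),z\rangle$, $$\int_X u\,\big(\langle R\nabla\varphi,z\rangle-v_z\varphi\big)\,d\nu=-\int_X\varphi\,dm_z\qquad\text{for all }z\in X,\ \varphi\in C^1_b(X).\tag{1}$$ **Theorem.** Let $u\in L^p(X,\nu)$ for some $p>1$. Then $u\in BV(X,\nu)$ if and only if $V(u)<+\infty$. In this case, every $X$-valued measure $m$ of finite total variation satisfying (1) has $|m|(X)=V(u)$. -/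

import Mathlib

open MeasureTheory Filter Topology
open scoped ENNReal Gradient

noncomputable section

namespace HilbertBV

variable {X : Type*} [NormedAddCommGroup X] [InnerProductSpace ℝ X] [CompleteSpace X]

/-- `C¹_b(X)`: bounded, continuously Fréchet differentiable real functions on `X` with bounded
gradient. -/
def IsCb1 (φ : X → ℝ) : Prop :=
  ContDiff ℝ 1 φ ∧ (∃ C : ℝ, ∀ x, |φ x| ≤ C) ∧ (∃ C : ℝ, ∀ x, ‖∇ φ x‖ ≤ C)

/-- The vector fields `F = ∑ᵢ fᵢ zᵢ` (finite sum) with `fᵢ ∈ C¹_b(X)` and `zᵢ ∈ X`. -/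
def IsCb1Field (F : X → X) : Prop :=
  ∃ (n : ℕ) (f : Fin n → X → ℝ) (z : Fin n → X),
    (∀ i, IsCb1 (f i)) ∧ ∀ x, F x = ∑ i, f i x • z i

variable [MeasurableSpace X]

/-- For every `z ∈ X` the function `v z` belongs to `L^p(X, ν)` for all `p ∈ (1, ∞)` and
`∫ ⟨R∇φ, z⟩ dν = ∫ v_z φ dν` for all `φ ∈ C¹_b(X)`. -/
def IsIBPFamily (ν : Measure X) (R : X →L[ℝ] X) (v : X → X → ℝ) : Prop :=
  ∀ z : X,
    (∀ p : ℝ, 1 < p → MemLp (v z) (ENNReal.ofReal p) ν) ∧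
    ∀ φ : X → ℝ, IsCb1 φ →
      ∫ x, inner ℝ (R (∇ φ x)) z ∂ν = ∫ x, v z x * φ x ∂ν

/-- `(φ, G)` lies in the graph of `M_p`, the closure in `L^p(X, ν) × L^p(X, ν; X)` of the operator
`R∇` with domain `C¹_b(X)`: that is, `φ ∈ W^{1,p}(X, ν)` and `M_p φ = G`. -/
def IsGenGradient (ν : Measure X) (R : X →L[ℝ] X) (p : ℝ≥0∞) (φ : X → ℝ) (G : X → X) : Prop :=
  MemLp φ p ν ∧ MemLp G p ν ∧
  ∃ φn : ℕ → X → ℝ, (∀ n, IsCb1 (φn n)) ∧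
    Tendsto (fun n => eLpNorm (fun x => φn n x - φ x) p ν) atTop (𝓝 0) ∧
    Tendsto (fun n => eLpNorm (fun x => R (∇ (φn n) x) - G x) p ν) atTop (𝓝 0)

/-- `F` belongs to the domain of the adjoint `M_p^* : D(M_p^*) ⊆ L^q(X, ν; X) → L^q(X, ν)` of `M_p`,
and `M_p^* F = g`, where `q` is the exponent conjugate to `p`. -/
def IsAdjointValue (ν : Measure X) (R : X →L[ℝ] X) (p q : ℝ≥0∞) (F : X → X) (g : X → ℝ) : Prop :=
  MemLp F q ν ∧ MemLp g q ν ∧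
  ∀ (φ : X → ℝ) (G : X → X), IsGenGradient ν R p φ G →
    ∫ x, inner ℝ (G x) (F x) ∂ν = ∫ x, φ x * g x ∂ν

/-- `F` belongs to `D(M_p^*)` for every `p ∈ (1, ∞)`, and `M^* F = g`, where `M^* F` denotes the
common value of `M_p^* F` for all such `p`. -/
def IsMStar (ν : Measure X) (R : X →L[ℝ] X) (F : X → X) (g : X → ℝ) : Prop :=
  ∀ p q : ℝ, p.HolderConjugate q →
    IsAdjointValue ν R (ENNReal.ofReal p) (ENNReal.ofReal q) F g

/-- `V(u) = sup { ∫ u M^*F dν }`, the supremum being over all the fields `F = ∑ᵢ fᵢ zᵢ` as in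
`IsCb1Field` such that `‖F x‖ ≤ 1` for every `x`. -/
def V (ν : Measure X) (R : X →L[ℝ] X) (u : X → ℝ) : EReal :=
  sSup {a : EReal | ∃ (F : X → X) (g : X → ℝ),
    IsCb1Field F ∧ (∀ x, ‖F x‖ ≤ 1) ∧ IsMStar ν R F g ∧
    a = ((∫ x, u x * g x ∂ν : ℝ) : EReal)}

/-- The scalar measure `m_z(B) = ⟨m(B), z⟩` of an `X`-valued measure `m`. -/
def component (m : VectorMeasure X X) (z : X) : SignedMeasure X :=
  m.mapRange (innerSL ℝ z).toAddMonoidHom (innerSL ℝ z).continuous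

/-- `m` is an `X`-valued measure with finite total variation that satisfies the integration by
parts formula which defines functions of bounded variation. -/
def IsBVMeasure (ν : Measure X) (R : X →L[ℝ] X) (v : X → X → ℝ) (u : X → ℝ)
    (m : VectorMeasure X X) : Prop :=
  m.variation Set.univ < ∞ ∧
  ∀ (z : X) (φ : X → ℝ), IsCb1 φ →
    ∫ x, u x * (inner ℝ (R (∇ φ x)) z - v z x * φ x) ∂ν = - ∫ᵛ x, φ x ∂•(component m z)

/-- `u ∈ BV(X, ν)`. -/
def MemBV (ν : Measure X) (R : X →L[ℝ] X) (v : X → X → ℝ) (u : X → ℝ) : Prop :=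
  Integrable u ν ∧ (∀ z : X, Integrable (fun x => u x * v z x) ν) ∧
  ∃ m : VectorMeasure X X, IsBVMeasure ν R v u m

end HilbertBV

end

/-!
Fix `r > 1` with `u ∈ L^r(ν)`. For a field `F = ∑ fᵢ zᵢ` the function
`∑ᵢ (v_{zᵢ} fᵢ - ⟨R∇fᵢ, zᵢ⟩)` is a value of `M^*F`: the integration by parts formula, applied to
products `fᵢ φ`, passes to the closure of `R∇` (`IsIBPFamily.isMStar_sum`). It is the only one up to
`ν`-null sets, because `C¹_b` functions approximate indicators (`IsMStar.ae_eq`). Hence the defining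
property of a BV measure `m` says exactly that `∫ u M^*F dν = ∫ ⟨F, dm⟩` for all such fields
(`IsBVMeasure.integral_mul_eq`).

Suppose that `m` is a BV measure. Since `|∫ ⟨F, dm⟩| ≤ |m|(X) sup ‖F‖`, we have `V(u) ≤ |m|(X)`.
Conversely, let `B₁, …, B_k` be disjoint Borel sets. Fields `∑ g_i m(B_i) / ‖m(B_i)‖`, where the
`g_i ≥ 0` are in `C¹_b`, have sum at most `1` and converge `|m|`-almost everywhere to the indicators
of the `B_i`, show that `∑ ‖m(B_i)‖ ≤ V(u)`. So `|m|(X) = V(u)` (`IsBVMeasure.variation_eq_V`).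

Suppose that `C = V(u)` is finite. Then `F ↦ ∫ u M^*F dν` is bounded by `C sup ‖F‖`, but `X` is not
locally compact, so a representation theorem does not apply on `X` itself. The coordinates in a
Hilbert basis embed `X` in the compact space `[-∞, ∞]^ι`. There the M. Riesz extension theorem and
the Riesz–Markov–Kakutani theorem give a finite measure `μ` with `∫ u M^*F dν ≤ ∫ h dμ` whenever `h`
is continuous and `‖F‖ ≤ h` on `X` (`exists_measure_of_cone`, `exists_measure_of_bounded`). If `F`
has bounded support and `P_S` are the orthogonal projections onto the spans of finite sets `S` of
basis vectors, then `‖F ∘ P_S‖` extends continuously to `[-∞, ∞]^ι`, and as `S` grows the extensions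
tend to `‖F‖` on `X` and to `0` outside `X`: the extensions vanish once `S` contains an infinite
coordinate, and the truncations of a family of reals outside `ℓ²` leave every ball. The functional converges along `F ∘ P_S` by dominated convergence, so
`∫ u M^*F dν ≤ ∫ ‖F‖ dμ` with `μ` restricted to `X`, and a smooth cutoff removes the assumption on
the support (`IsIBPFamily.exists_dominating_measure`). By the Cauchy–Schwarz inequality the
functional is continuous for the norm of `L²(μ; X)`, so the Fréchet–Riesz theorem gives
`σ ∈ L²(μ; X)` with `∫ u M^*F dν = ∫ ⟨σ, F⟩ dμ`, and `m = σ μ` is a BV measure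
(`IsIBPFamily.exists_isBVMeasure`).
-/

noncomputable section

namespace HilbertBV

/-! ### The class `C¹_b` -/

section ClassCb1

section Cutoff

variable {X : Type*} [NormedAddCommGroup X]

/-- A `C¹_b` cutoff function on `X`: it is `1` on the unit ball and vanishes where `2 ≤ ‖x‖ ^ 2`. -/
def cutoff (x : X) : ℝ := Real.smoothTransition (2 - ‖x‖ ^ 2)

lemma cutoff_nonneg (x : X) : 0 ≤ cutoff x := Real.smoothTransition.nonneg _

lemma cutoff_le_one (x : X) : cutoff x ≤ 1 := Real.smoothTransition.le_one _

lemma cutoff_eq_one {x : X} (hx : ‖x‖ ≤ 1) : cutoff x = 1 :=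
  Real.smoothTransition.one_of_one_le (by nlinarith [norm_nonneg x])

lemma cutoff_eq_zero {x : X} (hx : 2 ≤ ‖x‖ ^ 2) : cutoff x = 0 :=
  Real.smoothTransition.zero_of_nonpos (by linarith)

end Cutoff

variable {X : Type*} [NormedAddCommGroup X] [InnerProductSpace ℝ X] [CompleteSpace X]

lemma norm_gradient (f : X → ℝ) (x : X) : ‖∇ f x‖ = ‖fderiv ℝ f x‖ := by
  rw [gradient, LinearIsometryEquiv.norm_map]

lemma inner_map_gradient (R : X →L[ℝ] X) (f : X → ℝ) (x z : X) :
    inner ℝ (R (∇ f x)) z = fderiv ℝ f x (R.adjoint z) := by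
  rw [← ContinuousLinearMap.adjoint_inner_right, gradient,
    InnerProductSpace.toDual_symm_apply]

lemma isCb1_iff {f : X → ℝ} :
    IsCb1 f ↔ ContDiff ℝ 1 f ∧ (∃ C : ℝ, ∀ x, |f x| ≤ C) ∧ ∃ C : ℝ, ∀ x, ‖fderiv ℝ f x‖ ≤ C := by
  simp only [IsCb1, norm_gradient]

namespace IsCb1

variable {f g : X → ℝ}

lemma continuous (hf : IsCb1 f) : Continuous f := hf.1.continuous

lemma differentiable (hf : IsCb1 f) : Differentiable ℝ f := hf.1.differentiable one_ne_zero

lemma exists_bound (hf : IsCb1 f) : ∃ C : ℝ, 0 ≤ C ∧ ∀ x, |f x| ≤ C := by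
  obtain ⟨C, hC⟩ := hf.2.1
  exact ⟨C, (abs_nonneg _).trans (hC 0), hC⟩

lemma exists_fderiv_bound (hf : IsCb1 f) : ∃ C : ℝ, 0 ≤ C ∧ ∀ x, ‖fderiv ℝ f x‖ ≤ C := by
  obtain ⟨C, hC⟩ := (isCb1_iff.1 hf).2.2
  exact ⟨C, (norm_nonneg _).trans (hC 0), hC⟩

lemma continuous_fderiv (hf : IsCb1 f) : Continuous (fderiv ℝ f) :=
  hf.1.continuous_fderiv one_ne_zero

lemma const (c : ℝ) : IsCb1 (fun _ : X => c) :=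
  isCb1_iff.2 ⟨contDiff_const, ⟨|c|, fun _ => le_rfl⟩, 0, fun x => by simp⟩

lemma add (hf : IsCb1 f) (hg : IsCb1 g) : IsCb1 (fun x => f x + g x) := by
  obtain ⟨A, -, hA⟩ := hf.exists_bound
  obtain ⟨B, -, hB⟩ := hg.exists_bound
  obtain ⟨A', -, hA'⟩ := hf.exists_fderiv_bound
  obtain ⟨B', -, hB'⟩ := hg.exists_fderiv_bound
  refine isCb1_iff.2 ⟨hf.1.add hg.1, ⟨A + B, fun x => ?_⟩, A' + B', fun x => ?_⟩
  · exact (abs_add_le _ _).trans (add_le_add (hA x) (hB x))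
  · rw [fderiv_fun_add (hf.differentiable x) (hg.differentiable x)]
    exact (norm_add_le _ _).trans (add_le_add (hA' x) (hB' x))

lemma mul (hf : IsCb1 f) (hg : IsCb1 g) : IsCb1 (fun x => f x * g x) := by
  obtain ⟨A, hA0, hA⟩ := hf.exists_bound
  obtain ⟨B, hB0, hB⟩ := hg.exists_bound
  obtain ⟨A', -, hA'⟩ := hf.exists_fderiv_bound
  obtain ⟨B', -, hB'⟩ := hg.exists_fderiv_bound
  refine isCb1_iff.2 ⟨hf.1.mul hg.1, ⟨A * B, fun x => ?_⟩, A * B' + B * A', fun x => ?_⟩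
  · rw [abs_mul]
    exact mul_le_mul (hA x) (hB x) (abs_nonneg _) hA0
  · rw [fderiv_fun_mul (hf.differentiable x) (hg.differentiable x)]
    refine (norm_add_le _ _).trans ?_
    rw [norm_smul, norm_smul, Real.norm_eq_abs, Real.norm_eq_abs]
    gcongr
    exacts [hA x, hB' x, hB x, hA' x]

lemma const_mul (c : ℝ) (hf : IsCb1 f) : IsCb1 (fun x => c * f x) := (const c).mul hf

lemma one_sub (hf : IsCb1 f) : IsCb1 (fun x => 1 - f x) := by
  simpa [sub_eq_add_neg] using (const (X := X) 1).add (hf.const_mul (-1))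

lemma prod {α : Type*} (s : Finset α) {f : α → X → ℝ} (hf : ∀ i ∈ s, IsCb1 (f i)) :
    IsCb1 (fun x => ∏ i ∈ s, f i x) := by
  classical
  induction s using Finset.induction_on with
  | empty => simpa using const (X := X) 1
  | insert a s ha ih =>
    simp only [Finset.prod_insert ha]
    exact (hf a (by simp)).mul (ih fun i hi => hf i (by simp [hi]))

lemma comp_affine (hf : IsCb1 f) (A : X →L[ℝ] X) (c : X) : IsCb1 (fun x => f (A x + c)) := by
  obtain ⟨B, -, hB⟩ := hf.exists_bound
  obtain ⟨B', hB0, hB'⟩ := hf.exists_fderiv_bound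
  refine isCb1_iff.2 ⟨hf.1.comp (A.contDiff.add contDiff_const), ⟨B, fun x => hB _⟩,
    B' * ‖A‖, fun x => ?_⟩
  have h : HasFDerivAt (fun x => f (A x + c)) ((fderiv ℝ f (A x + c)).comp A) x :=
    (hf.differentiable (A x + c)).hasFDerivAt.comp x (A.hasFDerivAt.add_const c)
  rw [h.fderiv]
  exact (ContinuousLinearMap.opNorm_comp_le _ _).trans (by gcongr; exact hB' _)

lemma fderiv_comp_clm (hf : IsCb1 f) (A : X →L[ℝ] X) (x : X) :
    fderiv ℝ (fun x => f (A x)) x = (fderiv ℝ f (A x)).comp A :=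
  ((hf.differentiable (A x)).hasFDerivAt.comp x A.hasFDerivAt).fderiv

lemma comp_clm (hf : IsCb1 f) (A : X →L[ℝ] X) : IsCb1 (fun x => f (A x)) := by
  simpa using hf.comp_affine A 0

end IsCb1

lemma isCb1_cutoff : IsCb1 (cutoff : X → ℝ) := by
  have hs : ContDiff ℝ 1 Real.smoothTransition := Real.smoothTransition.contDiff
  have hc : ContDiff ℝ 1 (cutoff : X → ℝ) := hs.comp (contDiff_const.sub (contDiff_norm_sq ℝ))
  obtain ⟨D, hD⟩ := (isCompact_Icc (a := (0 : ℝ)) (b := 2)).exists_bound_of_continuousOn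
    (hs.continuous_deriv le_rfl).continuousOn
  refine isCb1_iff.2 ⟨hc, ⟨1, fun x => ?_⟩, D * 4, fun x => ?_⟩
  · rw [abs_of_nonneg (cutoff_nonneg x)]
    exact cutoff_le_one x
  have hD0 : 0 ≤ D := (norm_nonneg _).trans (hD 0 (by simp))
  rcases lt_or_ge 2 (‖x‖ ^ 2) with hx | hx
  · have : (cutoff : X → ℝ) =ᶠ[𝓝 x] fun _ => 0 := by
      have : ∀ᶠ y : X in 𝓝 x, 2 < ‖y‖ ^ 2 :=
        (continuous_norm.pow 2).continuousAt.eventually_const_lt hx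
      filter_upwards [this] with y hy using cutoff_eq_zero hy.le
    rw [this.fderiv_eq]
    simpa using by positivity
  · have h1 : HasFDerivAt (fun y : X => 2 - ‖y‖ ^ 2) (-(2 • innerSL ℝ x)) x :=
      (hasStrictFDerivAt_norm_sq x).hasFDerivAt.const_sub 2
    have h2 := ((hs.differentiable one_ne_zero _).hasDerivAt).comp_hasFDerivAt x h1
    have h3 : ‖x‖ ≤ 2 := by nlinarith [norm_nonneg x]
    rw [show fderiv ℝ cutoff x = _ from h2.fderiv, norm_smul, norm_neg]
    refine mul_le_mul (hD _ ⟨by linarith, by nlinarith [norm_nonneg x]⟩) ?_ (norm_nonneg _) hD0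
    refine (norm_nsmul_le).trans ?_
    rw [innerSL_apply_norm]
    norm_num
    linarith

/-- The indicator of a compact set is a pointwise limit of `C¹_b` functions with values in
`[0, 1]`. -/
lemma exists_isCb1_tendsto_indicator_of_isCompact {K : Set X} (hK : IsCompact K) :
    ∃ f : ℕ → X → ℝ, (∀ n, IsCb1 (f n)) ∧ (∀ n x, 0 ≤ f n x ∧ f n x ≤ 1) ∧
      ∀ x, Tendsto (fun n => f n x) atTop (𝓝 (K.indicator 1 x)) := by
  have key : ∀ n : ℕ, ∃ f : X → ℝ, IsCb1 f ∧ (∀ x, 0 ≤ f x ∧ f x ≤ 1) ∧ (∀ x ∈ K, f x = 1) ∧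
      ∀ x, (∀ y ∈ K, 2 * (1 / ((n : ℝ) + 1)) ≤ dist x y) → f x = 0 := by
    intro n
    have hn : (0 : ℝ) < n + 1 := by positivity
    obtain ⟨t, htK, ht⟩ := hK.elim_nhds_subcover (fun c => Metric.ball c (1 / ((n : ℝ) + 1)))
      (fun c _ => Metric.ball_mem_nhds c (by positivity))
    -- the rescaled bump centred at `c`
    set β : X → X → ℝ := fun c x => cutoff (((n : ℝ) + 1) • (x - c)) with hβ
    have hβC : ∀ c, IsCb1 (β c) := fun c => by
      simpa [hβ, smul_sub, sub_eq_add_neg] using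
        isCb1_cutoff.comp_affine (((n : ℝ) + 1) • ContinuousLinearMap.id ℝ X)
          (-(((n : ℝ) + 1) • c))
    have hβ0 : ∀ c x, 0 ≤ 1 - β c x := fun c x => sub_nonneg.2 (cutoff_le_one _)
    have hβ1 : ∀ c x, 1 - β c x ≤ 1 := fun c x => sub_le_self _ (cutoff_nonneg _)
    refine ⟨fun x => 1 - ∏ c ∈ t, (1 - β c x),
      (IsCb1.prod t fun c _ => (hβC c).one_sub).one_sub, fun x => ⟨?_, ?_⟩, fun x hx => ?_,
      fun x hx => ?_⟩
    · exact sub_nonneg.2 (Finset.prod_le_one (fun c _ => hβ0 c x) fun c _ => hβ1 c x)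
    · exact sub_le_self _ (Finset.prod_nonneg fun c _ => hβ0 c x)
    · obtain ⟨c, hct, hc⟩ := Set.mem_iUnion₂.1 (ht hx)
      have : β c x = 1 := by
        refine cutoff_eq_one ?_
        rw [norm_smul, Real.norm_of_nonneg hn.le, ← dist_eq_norm]
        have := (Metric.mem_ball.1 hc).le
        rw [le_div_iff₀ hn] at this
        linarith
      change 1 - ∏ c ∈ t, (1 - β c x) = 1
      rw [Finset.prod_eq_zero hct (by simp [this]), sub_zero]
    · have : ∀ c ∈ t, 1 - β c x = 1 := fun c hc => by
        have h := hx c (htK c hc)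
        have h2 : 2 ≤ ‖((n : ℝ) + 1) • (x - c)‖ := by
          rw [norm_smul, Real.norm_of_nonneg hn.le, ← dist_eq_norm]
          have := mul_le_mul_of_nonneg_left h hn.le
          field_simp at this
          linarith
        simp only [hβ]
        rw [cutoff_eq_zero (by nlinarith), sub_zero]
      change 1 - ∏ c ∈ t, (1 - β c x) = 0
      rw [Finset.prod_congr rfl this]
      simp
  choose f hf hf01 hf1 hf0 using key
  refine ⟨f, hf, hf01, fun x => ?_⟩
  by_cases hx : x ∈ K
  · simp [hx, hf1 _ x hx]
  · rw [Set.indicator_of_notMem hx]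
    obtain ⟨ε, hε, hεK⟩ := Metric.isOpen_iff.1 hK.isClosed.isOpen_compl x hx
    have h1 : ∀ᶠ n : ℕ in atTop, 2 * (1 / ((n : ℝ) + 1)) < ε := by
      have := (tendsto_one_div_add_atTop_nhds_zero_nat (𝕜 := ℝ)).const_mul 2
      rw [mul_zero] at this
      exact this.eventually_lt_const hε
    refine tendsto_const_nhds.congr' ?_
    filter_upwards [h1] with n hn
    refine (hf0 n x fun y hy => hn.le.trans ?_).symm
    by_contra! h
    exact hεK (by rwa [Metric.mem_ball, dist_comm]) hy

/-- `C¹_b` functions with values in `[0, 1]` approximate indicators almost everywhere. Since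
`X` is Polish, a measurable set is filled up to a null set by compact sets. -/
lemma exists_isCb1_tendsto_indicator [TopologicalSpace.SeparableSpace X] [MeasurableSpace X]
    [BorelSpace X] (μ : Measure X) [IsFiniteMeasure μ] {A : Set X} (hA : MeasurableSet A) :
    ∃ f : ℕ → X → ℝ, (∀ n, IsCb1 (f n)) ∧ (∀ n x, 0 ≤ f n x ∧ f n x ≤ 1) ∧
      ∀ᵐ x ∂μ, Tendsto (fun n => f n x) atTop (𝓝 (A.indicator 1 x)) := by
  have : SecondCountableTopology X := UniformSpace.secondCountable_of_separable X
  have hmeas : AEStronglyMeasurable (A.indicator (1 : X → ℝ)) μ :=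
    (measurable_one.indicator hA).aestronglyMeasurable
  have key : ∀ n : ℕ, ∃ f : X → ℝ, IsCb1 f ∧ (∀ x, 0 ≤ f x ∧ f x ≤ 1) ∧
      eLpNorm (f - A.indicator 1) 1 μ ≤ 1 / ((n : ℝ≥0∞) + 1) := by
    intro n
    have hn : (1 / ((n : ℝ≥0∞) + 1) / 2) ≠ 0 := by simp
    obtain ⟨K, hKA, hK, hlt⟩ := hA.exists_isCompact_sdiff_lt (measure_ne_top μ A) hn
    obtain ⟨f, hf, hf01, hfK⟩ := exists_isCb1_tendsto_indicator_of_isCompact hK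
    have hKmeas : AEStronglyMeasurable (K.indicator (1 : X → ℝ)) μ :=
      (measurable_one.indicator hK.measurableSet).aestronglyMeasurable
    have hlim : Tendsto (fun m => eLpNorm (f m - K.indicator 1) 1 μ) atTop (𝓝 0) := by
      have := tendsto_lintegral_norm_of_dominated_convergence (μ := μ) (bound := fun _ => (1 : ℝ))
        (F := f) (f := K.indicator 1) (fun m => (hf m).continuous.aestronglyMeasurable)
        (integrable_const _).hasFiniteIntegral
        (fun m => Eventually.of_forall fun x => by
          rw [Real.norm_of_nonneg (hf01 m x).1]; exact (hf01 m x).2)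
        (Eventually.of_forall hfK)
      simpa [eLpNorm_one_eq_lintegral_enorm, ← ofReal_norm] using this
    obtain ⟨m, hm⟩ := (hlim.eventually_lt_const (pos_iff_ne_zero.2 hn)).exists
    refine ⟨f m, hf m, hf01 m, ?_⟩
    have hdiff : eLpNorm (K.indicator 1 - A.indicator (1 : X → ℝ)) 1 μ = μ (A \ K) := by
      have : K.indicator 1 - A.indicator (1 : X → ℝ) = (A \ K).indicator fun _ => -1 := by
        ext x
        by_cases h1 : x ∈ K
        · simp [h1, hKA h1]
        · by_cases h2 : x ∈ A <;> simp [h1, h2]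
      rw [this, eLpNorm_indicator_const (hA.diff hK.measurableSet) one_ne_zero ENNReal.one_ne_top]
      simp
    calc eLpNorm (f m - A.indicator 1) 1 μ
        = eLpNorm ((f m - K.indicator 1) + (K.indicator 1 - A.indicator 1)) 1 μ := by
          rw [sub_add_sub_cancel]
      _ ≤ eLpNorm (f m - K.indicator 1) 1 μ + eLpNorm (K.indicator 1 - A.indicator 1) 1 μ :=
          eLpNorm_add_le ((hf m).continuous.aestronglyMeasurable.sub hKmeas) (hKmeas.sub hmeas)
            le_rfl
      _ ≤ 1 / ((n : ℝ≥0∞) + 1) / 2 + 1 / ((n : ℝ≥0∞) + 1) / 2 :=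
          add_le_add hm.le (hdiff ▸ hlt.le)
      _ = 1 / ((n : ℝ≥0∞) + 1) := ENNReal.add_halves _
  choose f hf hf01 hfA using key
  have h0 : Tendsto (fun n => eLpNorm (f n - A.indicator 1) 1 μ) atTop (𝓝 0) := by
    refine tendsto_of_tendsto_of_tendsto_of_le_of_le tendsto_const_nhds ?_ (fun _ => zero_le)
      hfA
    have := ENNReal.tendsto_inv_nat_nhds_zero.comp (tendsto_add_atTop_nat 1)
    simpa [Function.comp_def] using this
  obtain ⟨ns, -, hns⟩ := (tendstoInMeasure_of_tendsto_eLpNorm one_ne_zero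
    (fun n => (hf n).continuous.aestronglyMeasurable) hmeas h0).exists_seq_tendsto_ae
  exact ⟨fun n => f (ns n), fun n => hf _, fun n => hf01 _, hns⟩

end ClassCb1

/-! ### Divergences of `C¹_b` fields -/

section Divergence

/-- Hölder continuity of the pairing `L^p × L^q → ℝ` in its first argument. -/
lemma tendsto_integral_inner_of_eLpNorm {α E ι : Type*} [MeasurableSpace α] {ν : Measure α}
    [NormedAddCommGroup E] [InnerProductSpace ℝ E] {p q : ℝ≥0∞} [p.HolderConjugate q]
    {l : Filter ι} {a : ι → α → E} {A b : α → E} (ha : ∀ n, MemLp (a n) p ν) (hA : MemLp A p ν)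
    (hb : MemLp b q ν) (h : Tendsto (fun n => eLpNorm (fun x => a n x - A x) p ν) l (𝓝 0)) :
    Tendsto (fun n => ∫ x, inner ℝ (a n x) (b x) ∂ν) l (𝓝 (∫ x, inner ℝ (A x) (b x) ∂ν)) := by
  have hint : ∀ c : α → E, MemLp c p ν → Integrable (fun x => inner ℝ (c x) (b x)) ν := fun c hc =>
    memLp_one_iff_integrable.1 <| hc.of_bilin (fun u w => inner ℝ u w) 1 hb
      (hc.1.inner hb.1) (.of_forall fun x => by simpa using nnnorm_inner_le_nnnorm (𝕜 := ℝ) _ _)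
  refine tendsto_integral_of_L1' _ (hint A hA).1 (.of_forall fun n => hint _ (ha n)) ?_
  have hle : ∀ n, eLpNorm ((fun x => inner ℝ (a n x) (b x)) - fun x => inner ℝ (A x) (b x)) 1 ν ≤
      eLpNorm (fun x => a n x - A x) p ν * eLpNorm b q ν := fun n => by
    have : ((fun x => inner ℝ (a n x) (b x)) - fun x => inner ℝ (A x) (b x)) =
        fun x => inner ℝ (a n x - A x) (b x) := by
      ext x; simp [inner_sub_left]
    rw [this]
    simpa [Pi.sub_def] using eLpNorm_le_eLpNorm_mul_eLpNorm_of_nnnorm (p := p) (q := q) (r := 1)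
      ((ha n).1.sub hA.1) hb.1
      (fun u w => inner ℝ u w) 1
      (.of_forall fun x => by simpa using nnnorm_inner_le_nnnorm (𝕜 := ℝ) _ _)
  refine tendsto_of_tendsto_of_tendsto_of_le_of_le tendsto_const_nhds ?_ (fun _ => zero_le) hle
  simpa using ENNReal.Tendsto.mul_const h (Or.inr hb.2.ne)

variable {X : Type*} [NormedAddCommGroup X] [InnerProductSpace ℝ X] [CompleteSpace X]

/-- The function `v_z f - ⟨R∇f, z⟩`, which is the value of `M^*` at the field `x ↦ f x • z`. -/
def mstar (R : X →L[ℝ] X) (v : X → X → ℝ) (f : X → ℝ) (z x : X) : ℝ :=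
  v z x * f x - fderiv ℝ f x (R.adjoint z)

namespace IsCb1

lemma continuous_fderiv_apply {f : X → ℝ} (hf : IsCb1 f) (w : X) :
    Continuous fun x => fderiv ℝ f x w :=
  hf.continuous_fderiv.clm_apply continuous_const

omit [CompleteSpace X] in
lemma abs_fderiv_apply_le {f : X → ℝ} {C : ℝ} (hC : ∀ x, ‖fderiv ℝ f x‖ ≤ C) (w x : X) :
    |fderiv ℝ f x w| ≤ C * ‖w‖ :=
  ((fderiv ℝ f x).le_opNorm w).trans (by gcongr; exact hC x)

end IsCb1

variable [TopologicalSpace.SeparableSpace X] [MeasurableSpace X] [BorelSpace X]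

namespace IsCb1

variable {f : X → ℝ}

lemma aestronglyMeasurable (hf : IsCb1 f) (ν : Measure X) : AEStronglyMeasurable f ν :=
  have : SecondCountableTopology X := UniformSpace.secondCountable_of_separable X
  hf.continuous.aestronglyMeasurable

lemma aestronglyMeasurable_fderiv_apply (hf : IsCb1 f) (w : X) (ν : Measure X) :
    AEStronglyMeasurable (fun x => fderiv ℝ f x w) ν :=
  have : SecondCountableTopology X := UniformSpace.secondCountable_of_separable X
  (hf.continuous_fderiv_apply w).aestronglyMeasurable

variable {ν : Measure X} [IsFiniteMeasure ν]

lemma memLp (hf : IsCb1 f) (p : ℝ≥0∞) : MemLp f p ν := by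
  obtain ⟨C, -, hC⟩ := hf.exists_bound
  exact .of_bound (hf.aestronglyMeasurable ν) C (.of_forall hC)

lemma memLp_smul (hf : IsCb1 f) (z : X) (p : ℝ≥0∞) : MemLp (fun x => f x • z) p ν := by
  obtain ⟨C, -, hC⟩ := hf.exists_bound
  refine .of_bound ((hf.aestronglyMeasurable ν).smul_const z) (C * ‖z‖) (.of_forall fun x => ?_)
  rw [norm_smul]
  gcongr
  exact hC x

lemma memLp_fderiv_apply (hf : IsCb1 f) (w : X) (p : ℝ≥0∞) :
    MemLp (fun x => fderiv ℝ f x w) p ν := by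
  obtain ⟨C, -, hC⟩ := hf.exists_fderiv_bound
  exact .of_bound (hf.aestronglyMeasurable_fderiv_apply w ν) (C * ‖w‖)
    (.of_forall fun x => abs_fderiv_apply_le hC w x)

lemma memLp_map_gradient (hf : IsCb1 f) (R : X →L[ℝ] X) (p : ℝ≥0∞) :
    MemLp (fun x => R (∇ f x)) p ν := by
  have : SecondCountableTopology X := UniformSpace.secondCountable_of_separable X
  obtain ⟨C, -, hC⟩ := hf.exists_fderiv_bound
  have hc : Continuous fun x => R (∇ f x) :=
    R.continuous.comp ((InnerProductSpace.toDual ℝ X).symm.continuous.comp hf.continuous_fderiv)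
  refine .of_bound hc.aestronglyMeasurable (‖R‖ * C) (.of_forall fun x => ?_)
  refine (R.le_opNorm _).trans ?_
  gcongr
  exact (norm_gradient f x).trans_le (hC x)

lemma isGenGradient (hf : IsCb1 f) (R : X →L[ℝ] X) (p : ℝ≥0∞) :
    IsGenGradient ν R p f fun x => R (∇ f x) :=
  ⟨hf.memLp p, hf.memLp_map_gradient R p, fun _ => f, fun _ => hf, by simp, by simp⟩

end IsCb1

variable {ν : Measure X} [IsFiniteMeasure ν] {R : X →L[ℝ] X} {v : X → X → ℝ}

omit [IsFiniteMeasure ν] in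
lemma memLp_mul_isCb1 {w f : X → ℝ} {p : ℝ≥0∞} (hw : MemLp w p ν) (hf : IsCb1 f) :
    MemLp (fun x => w x * f x) p ν := by
  obtain ⟨C, hC0, hC⟩ := hf.exists_bound
  refine hw.of_le_mul (hw.1.mul (hf.aestronglyMeasurable ν)) (c := C) (.of_forall fun x => ?_)
  rw [norm_mul, mul_comm]
  gcongr
  exact hC x

lemma IsIBPFamily.memLp_mstar (hv : IsIBPFamily ν R v) {f : X → ℝ} (hf : IsCb1 f) (z : X) {p : ℝ}
    (hp : 1 < p) : MemLp (mstar R v f z) (ENNReal.ofReal p) ν :=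
  (memLp_mul_isCb1 ((hv z).1 p hp) hf).sub (hf.memLp_fderiv_apply _ _)

/-- The integration by parts formula with a factor `f`: by the Leibniz rule it is the defining
formula of `v z` at the product `f φ`. -/
lemma IsIBPFamily.integral_fderiv_mul (hv : IsIBPFamily ν R v) {f φ : X → ℝ} (hf : IsCb1 f)
    (hφ : IsCb1 φ) (z : X) :
    ∫ x, fderiv ℝ φ x (R.adjoint z) * f x ∂ν = ∫ x, φ x * mstar R v f z x ∂ν := by
  have hi : Integrable (v z) ν := ((hv z).1 2 one_lt_two).integrable (by norm_num)
  have h1 : Integrable (fun x => v z x * (f x * φ x)) ν :=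
    memLp_one_iff_integrable.1
      (memLp_mul_isCb1 (memLp_one_iff_integrable.2 hi) (hf.mul hφ))
  have h2 : Integrable (fun x => fderiv ℝ φ x (R.adjoint z) * f x) ν :=
    memLp_one_iff_integrable.1 (memLp_mul_isCb1 (hφ.memLp_fderiv_apply _ _) hf)
  have h3 : Integrable (fun x => fderiv ℝ f x (R.adjoint z) * φ x) ν :=
    memLp_one_iff_integrable.1 (memLp_mul_isCb1 (hf.memLp_fderiv_apply _ _) hφ)
  have key := (hv z).2 _ (hf.mul hφ)
  have h4 : ∀ x, inner ℝ (R (∇ (fun x => f x * φ x) x)) z =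
      fderiv ℝ φ x (R.adjoint z) * f x + fderiv ℝ f x (R.adjoint z) * φ x := fun x => by
    rw [inner_map_gradient, fderiv_fun_mul (hf.differentiable x) (hφ.differentiable x)]
    simp [mul_comm]
  simp_rw [h4] at key
  rw [integral_add h2 h3] at key
  have h5 : ∀ x, φ x * mstar R v f z x =
      v z x * (f x * φ x) - fderiv ℝ f x (R.adjoint z) * φ x := fun x => by
    rw [mstar]; ring
  simp_rw [h5]
  rw [integral_sub h1 h3]
  linarith

/-- The field `x ↦ f x • z` lies in the domain of every `M_p^*`: the integration by parts formula,
applied to the product `f φ`, passes to the closure of `R∇`. -/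
lemma IsIBPFamily.isMStar_smul (hv : IsIBPFamily ν R v) {f : X → ℝ} (hf : IsCb1 f) (z : X) :
    IsMStar ν R (fun x => f x • z) (mstar R v f z) := by
  intro p q hpq
  have := hpq.ennrealOfReal
  have hg := hv.memLp_mstar hf z hpq.symm.lt
  refine ⟨hf.memLp_smul z _, hg, ?_⟩
  rintro φ G ⟨hφ, hG, φn, hφn, hlim, hlimG⟩
  have h1 := tendsto_integral_inner_of_eLpNorm (fun n => (hφn n).memLp_map_gradient R _) hG
    (hf.memLp_smul z (ENNReal.ofReal q)) hlimG
  have h2 := tendsto_integral_inner_of_eLpNorm (fun n => (hφn n).memLp _) hφ hg hlim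
  have h3 : ∀ n, ∫ x, inner ℝ (R (∇ (φn n) x)) (f x • z) ∂ν =
      ∫ x, inner ℝ (φn n x) (mstar R v f z x) ∂ν := fun n => by
    have := hv.integral_fderiv_mul hf (hφn n) z
    simpa [inner_smul_right, inner_map_gradient, mul_comm] using this
  simp_rw [h3] at h1
  simpa [mul_comm] using tendsto_nhds_unique h1 h2

namespace IsMStar

omit [TopologicalSpace.SeparableSpace X] [IsFiniteMeasure ν] [BorelSpace X] in
lemma integrable_pairings {p q : ℝ} (hpq : p.HolderConjugate q) {F : X → X} {g : X → ℝ}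
    (h : IsMStar ν R F g) {φ : X → ℝ} {G : X → X}
    (hG : IsGenGradient ν R (ENNReal.ofReal p) φ G) :
    Integrable (fun x => inner ℝ (G x) (F x)) ν ∧ Integrable (fun x => φ x * g x) ν := by
  have := hpq.ennrealOfReal
  obtain ⟨hF, hg, -⟩ := h p q hpq
  exact ⟨memLp_one_iff_integrable.1 <| hG.2.1.of_bilin (fun u w => inner ℝ u w) 1 hF
      (hG.2.1.1.inner hF.1) (.of_forall fun x => by
        simpa using nnnorm_inner_le_nnnorm (𝕜 := ℝ) _ _),
    hG.1.integrable_mul hg⟩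

omit [TopologicalSpace.SeparableSpace X] [IsFiniteMeasure ν] [BorelSpace X] in
lemma add {F F' : X → X} {g g' : X → ℝ} (h : IsMStar ν R F g) (h' : IsMStar ν R F' g') :
    IsMStar ν R (fun x => F x + F' x) (fun x => g x + g' x) := by
  intro p q hpq
  refine ⟨(h p q hpq).1.add (h' p q hpq).1, (h p q hpq).2.1.add (h' p q hpq).2.1,
    fun φ G hG => ?_⟩
  obtain ⟨h1, h2⟩ := h.integrable_pairings hpq hG
  obtain ⟨h1', h2'⟩ := h'.integrable_pairings hpq hG
  simp_rw [inner_add_right, mul_add]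
  rw [integral_add h1 h1', integral_add h2 h2', (h p q hpq).2.2 φ G hG, (h' p q hpq).2.2 φ G hG]

omit [TopologicalSpace.SeparableSpace X] [IsFiniteMeasure ν] [BorelSpace X] in
lemma const_smul (c : ℝ) {F : X → X} {g : X → ℝ} (h : IsMStar ν R F g) :
    IsMStar ν R (fun x => c • F x) (fun x => c * g x) := by
  intro p q hpq
  refine ⟨(h p q hpq).1.const_smul c, (h p q hpq).2.1.const_mul c, fun φ G hG => ?_⟩
  simp_rw [inner_smul_right, mul_left_comm _ c]
  rw [integral_const_mul, integral_const_mul, (h p q hpq).2.2 φ G hG]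

omit [TopologicalSpace.SeparableSpace X] [IsFiniteMeasure ν] [BorelSpace X] in
lemma zero : IsMStar ν R (fun _ => 0) (fun _ => 0) := fun p q _ => by
  refine ⟨MemLp.zero, MemLp.zero, fun φ G _ => by simp⟩

omit [TopologicalSpace.SeparableSpace X] [IsFiniteMeasure ν] [BorelSpace X] in
lemma sum {α : Type*} (s : Finset α) {F : α → X → X} {g : α → X → ℝ}
    (h : ∀ i ∈ s, IsMStar ν R (F i) (g i)) :
    IsMStar ν R (fun x => ∑ i ∈ s, F i x) (fun x => ∑ i ∈ s, g i x) := by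
  classical
  induction s using Finset.induction_on with
  | empty => simpa using zero
  | insert a s ha ih =>
    simp only [Finset.sum_insert ha]
    exact (h a (by simp)).add (ih fun i hi => h i (by simp [hi]))

/-- `M^*F` is determined up to a `ν`-null set, because `C¹_b` approximates indicators. -/
lemma ae_eq {F : X → X} {g g' : X → ℝ} (h : IsMStar ν R F g) (h' : IsMStar ν R F g') :
    g =ᵐ[ν] g' := by
  have h2 : (2 : ℝ).HolderConjugate 2 := .two_two
  have hi : ∀ {k}, IsMStar ν R F k → Integrable k ν := fun hk =>
    (hk 2 2 h2).2.1.integrable (by norm_num)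
  have hint := (hi h).sub (hi h')
  have hφ : ∀ φ, IsCb1 φ → ∫ x, φ x * (g x - g' x) ∂ν = 0 := fun φ hφ => by
    have hG := hφ.isGenGradient (ν := ν) R (ENNReal.ofReal 2)
    simp_rw [mul_sub]
    rw [integral_sub (h.integrable_pairings h2 hG).2 (h'.integrable_pairings h2 hG).2,
      ← (h 2 2 h2).2.2 _ _ hG, ← (h' 2 2 h2).2.2 _ _ hG, sub_self]
  suffices hz : (fun x => g x - g' x) =ᵐ[ν] 0 by
    filter_upwards [hz] with x hx using sub_eq_zero.1 hx
  refine hint.ae_eq_zero_of_forall_setIntegral_eq_zero fun A hA _ => ?_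
  obtain ⟨f, hf, hf01, hlim⟩ := exists_isCb1_tendsto_indicator ν hA
  have ht : Tendsto (fun n => ∫ x, f n x * (g x - g' x) ∂ν) atTop
      (𝓝 (∫ x, A.indicator 1 x * (g x - g' x) ∂ν)) := by
    refine tendsto_integral_of_dominated_convergence (fun x => ‖g x - g' x‖)
      (fun n => ((hf n).aestronglyMeasurable ν).mul hint.1) hint.norm
      (fun n => .of_forall fun x => ?_) ?_
    · rw [norm_mul, Real.norm_of_nonneg (hf01 n x).1]
      exact mul_le_of_le_one_left (norm_nonneg _) (hf01 n x).2
    · filter_upwards [hlim] with x hx using hx.mul_const _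
  simp_rw [hφ _ (hf _)] at ht
  rw [← integral_indicator hA, ← tendsto_nhds_unique ht tendsto_const_nhds]
  congr with x
  by_cases hx : x ∈ A <;> simp [hx]

lemma integral_mul_eq (u : X → ℝ) {F : X → X} {g g' : X → ℝ} (h : IsMStar ν R F g)
    (h' : IsMStar ν R F g') : ∫ x, u x * g x ∂ν = ∫ x, u x * g' x ∂ν := by
  refine integral_congr_ae ?_
  filter_upwards [h.ae_eq h'] with x hx
  rw [hx]

omit [TopologicalSpace.SeparableSpace X] [IsFiniteMeasure ν] [BorelSpace X] in
lemma integrable_mul {u : X → ℝ} {r : ℝ} (hr : 1 < r) (hu : MemLp u (ENNReal.ofReal r) ν)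
    {F : X → X} {g : X → ℝ} (h : IsMStar ν R F g) : Integrable (fun x => u x * g x) ν := by
  have hrs := Real.HolderConjugate.conjExponent hr
  have := hrs.ennrealOfReal
  exact hu.integrable_mul (h _ _ hrs).2.1

end IsMStar

lemma IsIBPFamily.isMStar_sum (hv : IsIBPFamily ν R v) {n : ℕ} {f : Fin n → X → ℝ}
    (hf : ∀ i, IsCb1 (f i)) (z : Fin n → X) :
    IsMStar ν R (fun x => ∑ i, f i x • z i) (fun x => ∑ i, mstar R v (f i) (z i) x) :=
  .sum _ fun i _ => hv.isMStar_smul (hf i) (z i)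

/-- The pairing `f ↦ ∫ u M^*(f z)` is continuous along bounded pointwise `C¹` convergence. No rate
is available, so this is the substitute for continuity in a norm. -/
lemma IsIBPFamily.tendsto_integral_mul_mstar (hv : IsIBPFamily ν R v) {u : X → ℝ} {r : ℝ}
    (hr : 1 < r) (hu : MemLp u (ENNReal.ofReal r) ν) {ι : Type*} {l : Filter ι}
    [l.IsCountablyGenerated] {f : ι → X → ℝ} {f₀ : X → ℝ} (hf : ∀ i, IsCb1 (f i)) (z : X)
    {C D : ℝ} (hC : ∀ i x, |f i x| ≤ C) (hD : ∀ i x, ‖fderiv ℝ (f i) x‖ ≤ D)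
    (hlim : ∀ x, Tendsto (fun i => f i x) l (𝓝 (f₀ x)))
    (hlim' : ∀ x w, Tendsto (fun i => fderiv ℝ (f i) x w) l (𝓝 (fderiv ℝ f₀ x w))) :
    Tendsto (fun i => ∫ x, u x * mstar R v (f i) z x ∂ν) l
      (𝓝 (∫ x, u x * mstar R v f₀ z x ∂ν)) := by
  have hui : Integrable u ν := hu.integrable (by simpa using hr.le)
  have hrs := Real.HolderConjugate.conjExponent hr
  have := hrs.ennrealOfReal
  have huv : Integrable (fun x => u x * v z x) ν :=
    hu.integrable_mul ((hv z).1 _ hrs.symm.lt)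
  refine tendsto_integral_filter_of_dominated_convergence
    (fun x => ‖u x * v z x‖ * C + ‖u x‖ * (D * ‖R.adjoint z‖)) (.of_forall fun i => ?_)
    (.of_forall fun i => .of_forall fun x => ?_) ?_ (.of_forall fun x => ?_)
  · exact ((hv.isMStar_smul (hf i) z).integrable_mul hr hu).1
  · rw [mstar, mul_sub, ← mul_assoc]
    refine (norm_sub_le _ _).trans ?_
    rw [norm_mul _ (f i x), norm_mul (u x) (fderiv ℝ (f i) x _)]
    gcongr
    exacts [hC i x, IsCb1.abs_fderiv_apply_le (hD i) _ x]
  · exact (huv.norm.mul_const C).add (hui.norm.mul_const _)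
  · exact (((hlim x).const_mul _).sub (hlim' x _)).const_mul _

end Divergence

/-! ### Integrals against vector measures -/

section VectorIntegral

section BoundedInduction

variable {α : Type*} [MeasurableSpace α]

/-- Two functionals on bounded functions agree on bounded strongly measurable functions if they
agree on indicators, are additive on simple functions and commute with bounded pointwise limits. -/
lemma eq_of_bounded_pointwise_limits {I J : (α → ℝ) → ℝ}
    (hind : ∀ (c : ℝ) (s : Set α), MeasurableSet s →
      I (s.indicator fun _ => c) = J (s.indicator fun _ => c))
    (hI : ∀ f g : SimpleFunc α ℝ, I (f + g : SimpleFunc α ℝ) = I f + I g)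
    (hJ : ∀ f g : SimpleFunc α ℝ, J (f + g : SimpleFunc α ℝ) = J f + J g)
    {f : α → ℝ} (hf : StronglyMeasurable f) {C : ℝ} (hC : ∀ x, ‖f x‖ ≤ C)
    (hIlim : ∀ fn : ℕ → SimpleFunc α ℝ, (∀ n x, ‖fn n x‖ ≤ C) →
      (∀ x, Tendsto (fun n => fn n x) atTop (𝓝 (f x))) →
        Tendsto (fun n => I (fn n)) atTop (𝓝 (I f)))
    (hJlim : ∀ fn : ℕ → SimpleFunc α ℝ, (∀ n x, ‖fn n x‖ ≤ C) →
      (∀ x, Tendsto (fun n => fn n x) atTop (𝓝 (f x))) →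
        Tendsto (fun n => J (fn n)) atTop (𝓝 (J f))) :
    I f = J f := by
  classical
  have hs : ∀ g : SimpleFunc α ℝ, I g = J g := fun g => by
    induction g using SimpleFunc.induction with
    | const c hs =>
      rw [SimpleFunc.coe_piecewise, SimpleFunc.coe_const, SimpleFunc.coe_const,
        Function.const_zero, Set.piecewise_eq_indicator]
      exact hind c _ hs
    | add _ h1 h2 => rw [hI, hJ, h1, h2]
  rcases isEmpty_or_nonempty α with hα | ⟨⟨x₀⟩⟩
  · rw [show f = (0 : SimpleFunc α ℝ) from Subsingleton.elim _ _]
    exact hs 0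
  have hC0 : 0 ≤ C := (norm_nonneg _).trans (hC x₀)
  have hb : ∀ n x, ‖hf.approxBounded C n x‖ ≤ C := fun n x => hf.norm_approxBounded_le hC0 n x
  have hl : ∀ x, Tendsto (fun n => hf.approxBounded C n x) atTop (𝓝 (f x)) := fun x =>
    hf.tendsto_approxBounded_of_norm_le (hC x)
  have h1 := hIlim _ hb hl
  have h2 := hJlim _ hb hl
  simp_rw [hs] at h1
  exact tendsto_nhds_unique h1 h2

end BoundedInduction

variable {X : Type*} [NormedAddCommGroup X] [InnerProductSpace ℝ X] [CompleteSpace X]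
  [MeasurableSpace X]

omit [CompleteSpace X] in
lemma component_apply (m : VectorMeasure X X) (z : X) (s : Set X) :
    component m z s = inner ℝ z (m s) := rfl

omit [CompleteSpace X] in
lemma isFiniteMeasure_variation_component (m : VectorMeasure X X) [IsFiniteMeasure m.variation]
    (z : X) : IsFiniteMeasure (component m z).variation := by
  have h : (component m z).variation ≤ ‖z‖₊ • m.variation := by
    refine VectorMeasure.variation_le_of_forall_enorm_le fun s hs => ?_
    rw [component_apply]
    calc ‖inner ℝ z (m s)‖ₑ ≤ ‖z‖ₑ * ‖m s‖ₑ := by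
          simp only [enorm_eq_nnnorm]
          exact_mod_cast nnnorm_inner_le_nnnorm (𝕜 := ℝ) z (m s)
      _ ≤ ‖z‖ₑ * m.variation s := by gcongr; exact VectorMeasure.enorm_measure_le_variation _ _
      _ = (‖z‖₊ • m.variation) s := by simp [enorm_eq_nnnorm]
  exact isFiniteMeasure_of_le _ h

omit [CompleteSpace X] in
/-- Integration of a scalar function against `m_z` is integration of a vector field of constant
direction `z` against `m`. -/
lemma integral_component (m : VectorMeasure X X) [IsFiniteMeasure m.variation] (z : X) {f : X → ℝ}
    (hf : StronglyMeasurable f) {C : ℝ} (hC : ∀ x, ‖f x‖ ≤ C) :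
    ∫ᵛ x, f x ∂•(component m z) = ∫ᵛ x, f x • z ∂[innerSL ℝ; m] := by
  have := isFiniteMeasure_variation_component m z
  have hint : ∀ g : SimpleFunc X ℝ, m.Integrable (fun x => g x • z) := fun g =>
    (SimpleFunc.integrable_of_isFiniteMeasure g).smul_const z
  refine eq_of_bounded_pointwise_limits
    (I := fun f => ∫ᵛ x, f x ∂•(component m z)) (J := fun f => ∫ᵛ x, f x • z ∂[innerSL ℝ; m])
    (fun c s hs => ?_) (fun f g => ?_) (fun f g => ?_) hf hC (fun fn hb hl => ?_)
    (fun fn hb hl => ?_)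
  · have : (fun x => s.indicator (fun _ => c) x • z) = s.indicator fun _ => c • z := by
      ext x; by_cases hx : x ∈ s <;> simp [hx]
    simp only [this]
    rw [VectorMeasure.integral_indicator_const _ hs, VectorMeasure.integral_indicator_const _ hs]
    simp only [ContinuousLinearMap.lsmul_apply, component_apply, smul_eq_mul, map_smul]
    rfl
  · exact VectorMeasure.integral_add (SimpleFunc.integrable_of_isFiniteMeasure f)
      (SimpleFunc.integrable_of_isFiniteMeasure g)
  · simp only [SimpleFunc.coe_add, Pi.add_apply, add_smul]
    exact VectorMeasure.integral_fun_add (hint f) (hint g)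
  · exact VectorMeasure.tendsto_integral_filter_of_norm_le_const
      (.of_forall fun n => (fn n).aestronglyMeasurable)
      ⟨C, .of_forall fun n => .of_forall fun x => hb n x⟩ (.of_forall hl)
  · refine VectorMeasure.tendsto_integral_filter_of_norm_le_const
      (.of_forall fun n => (fn n).aestronglyMeasurable.smul_const z)
      ⟨C * ‖z‖, .of_forall fun n => .of_forall fun x => ?_⟩
      (.of_forall fun x => (hl x).smul_const z)
    rw [norm_smul]
    gcongr
    exact hb n x

/-- Integration against a component of a vector measure that has a density. -/
lemma integral_component_withDensity {μ : Measure X} {σ : X → X} (hσ : Integrable σ μ) (z : X)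
    {f : X → ℝ} (hf : StronglyMeasurable f) {C : ℝ} (hC : ∀ x, ‖f x‖ ≤ C) :
    ∫ᵛ x, f x ∂•(component (μ.withDensityᵥ σ) z) = ∫ x, f x * inner ℝ (σ x) z ∂μ := by
  have hm : IsFiniteMeasure (μ.withDensityᵥ σ).variation := by
    rw [Measure.variation_withDensityᵥ hσ]
    exact isFiniteMeasure_withDensity hσ.2.ne
  have := isFiniteMeasure_variation_component (μ.withDensityᵥ σ) z
  have hσz : Integrable (fun x => inner ℝ (σ x) z) μ := hσ.inner_const z
  have hint : ∀ g : SimpleFunc X ℝ, Integrable (fun x => g x * inner ℝ (σ x) z) μ := fun g => by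
    obtain ⟨D, hD⟩ := g.exists_forall_norm_le
    exact hσz.bdd_mul g.aestronglyMeasurable (.of_forall hD)
  refine eq_of_bounded_pointwise_limits
    (I := fun f => ∫ᵛ x, f x ∂•(component (μ.withDensityᵥ σ) z))
    (J := fun f => ∫ x, f x * inner ℝ (σ x) z ∂μ)
    (fun c s hs => ?_) (fun f g => ?_) (fun f g => ?_) hf hC (fun fn hb hl => ?_)
    (fun fn hb hl => ?_)
  · have : (fun x => s.indicator (fun _ => c) x * inner ℝ (σ x) z) =
        s.indicator fun x => c * inner ℝ (σ x) z := by
      ext x; by_cases hx : x ∈ s <;> simp [hx]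
    simp only [this]
    rw [VectorMeasure.integral_indicator_const _ hs, integral_indicator hs, integral_const_mul]
    simp_rw [real_inner_comm z]
    rw [integral_inner hσ.integrableOn]
    simp [component_apply, withDensityᵥ_apply hσ hs]
  · exact VectorMeasure.integral_add (SimpleFunc.integrable_of_isFiniteMeasure f)
      (SimpleFunc.integrable_of_isFiniteMeasure g)
  · simp only [SimpleFunc.coe_add, Pi.add_apply, add_mul]
    exact integral_add (hint f) (hint g)
  · exact VectorMeasure.tendsto_integral_filter_of_norm_le_const
      (.of_forall fun n => (fn n).aestronglyMeasurable)
      ⟨C, .of_forall fun n => .of_forall fun x => hb n x⟩ (.of_forall hl)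
  · refine tendsto_integral_of_dominated_convergence (fun x => C * ‖inner ℝ (σ x) z‖)
      (fun n => (hint (fn n)).1) (hσz.norm.const_mul C) (fun n => .of_forall fun x => ?_)
      (.of_forall fun x => (hl x).mul_const _)
    rw [norm_mul]
    gcongr
    exact hb n x

end VectorIntegral

/-! ### The variation of a BV measure -/

section Variation

/-- If `0 ≤ a i ≤ 1`, the products `a i * ∏ j ≠ i, (1 - a j)` have sum at most `1`: for independent
events of probabilities `a i`, this is the probability that exactly one of them occurs. -/
lemma sum_mul_prod_one_sub_le_one {α : Type*} [DecidableEq α] (s : Finset α) (a : α → ℝ)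
    (ha : ∀ i ∈ s, 0 ≤ a i ∧ a i ≤ 1) :
    ∑ i ∈ s, a i * ∏ j ∈ s.erase i, (1 - a j) ≤ 1 := by
  induction s using Finset.induction_on with
  | empty => simp
  | insert k s hk ih =>
    have ih := ih fun i hi => ha i (by simp [hi])
    have hk01 := ha k (by simp)
    have hprod : ∏ j ∈ s, (1 - a j) ≤ 1 := Finset.prod_le_one
      (fun j hj => sub_nonneg.2 (ha j (by simp [hj])).2)
      fun j hj => sub_le_self _ (ha j (by simp [hj])).1
    have hstep : ∀ i ∈ s, a i * ∏ j ∈ (insert k s).erase i, (1 - a j) =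
        (1 - a k) * (a i * ∏ j ∈ s.erase i, (1 - a j)) := fun i hi => by
      have hik : i ≠ k := fun h => hk (h ▸ hi)
      rw [Finset.erase_insert_of_ne hik.symm, Finset.prod_insert (by simp [hk])]
      ring
    rw [Finset.sum_insert hk, Finset.erase_insert hk, Finset.sum_congr rfl hstep, ← Finset.mul_sum]
    nlinarith [mul_le_mul_of_nonneg_left ih (sub_nonneg.2 hk01.2),
      mul_le_mul_of_nonneg_left hprod hk01.1]

variable {X : Type*} [NormedAddCommGroup X] [InnerProductSpace ℝ X] [CompleteSpace X]
  [TopologicalSpace.SeparableSpace X] [MeasurableSpace X] [BorelSpace X]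
  {ν : Measure X} [IsFiniteMeasure ν] {R : X →L[ℝ] X} {v : X → X → ℝ} {u : X → ℝ} {r : ℝ}

omit [IsFiniteMeasure ν] in
lemma IsBVMeasure.integral_mul_mstar {m : VectorMeasure X X} (hm : IsBVMeasure ν R v u m)
    {f : X → ℝ} (hf : IsCb1 f) (z : X) :
    ∫ x, u x * mstar R v f z x ∂ν = ∫ᵛ x, f x • z ∂[innerSL ℝ; m] := by
  have : SecondCountableTopology X := UniformSpace.secondCountable_of_separable X
  have : IsFiniteMeasure m.variation := ⟨hm.1⟩
  obtain ⟨C, -, hC⟩ := hf.exists_bound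
  rw [← integral_component m z hf.continuous.stronglyMeasurable hC, ← neg_neg (∫ᵛ x, _ ∂•_),
    ← hm.2 z f hf, ← integral_neg]
  congr with x
  rw [inner_map_gradient, mstar]
  ring

/-- For a BV measure `m` and a `C¹_b` field `F`, `∫ u M^*F dν = ∫ ⟨F, dm⟩`. -/
lemma IsBVMeasure.integral_mul_eq (hv : IsIBPFamily ν R v) (hr : 1 < r)
    (hu : MemLp u (ENNReal.ofReal r) ν) {m : VectorMeasure X X} (hm : IsBVMeasure ν R v u m)
    {α : Type*} (s : Finset α) {f : α → X → ℝ} (hf : ∀ i ∈ s, IsCb1 (f i)) (z : α → X)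
    {g : X → ℝ} (hg : IsMStar ν R (fun x => ∑ i ∈ s, f i x • z i) g) :
    ∫ x, u x * g x ∂ν = ∫ᵛ x, ∑ i ∈ s, f i x • z i ∂[innerSL ℝ; m] := by
  have : IsFiniteMeasure m.variation := ⟨hm.1⟩
  have hs := fun i hi => hv.isMStar_smul (hf i hi) (z i)
  rw [hg.integral_mul_eq u (.sum s hs)]
  simp_rw [Finset.mul_sum]
  rw [integral_finsetSum s fun i hi => (hs i hi).integrable_mul hr hu,
    VectorMeasure.integral_finsetSum s fun i hi =>
      memLp_one_iff_integrable.1 ((hf i hi).memLp_smul (z i) 1)]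
  exact Finset.sum_congr rfl fun i hi => hm.integral_mul_mstar (hf i hi) (z i)

lemma IsBVMeasure.V_le (hv : IsIBPFamily ν R v) (hr : 1 < r)
    (hu : MemLp u (ENNReal.ofReal r) ν) {m : VectorMeasure X X} (hm : IsBVMeasure ν R v u m) :
    V ν R u ≤ ((m.variation Set.univ : ℝ≥0∞) : EReal) := by
  have hfin : IsFiniteMeasure m.variation := ⟨hm.1⟩
  refine sSup_le ?_
  rintro a ⟨F, g, ⟨n, f, z, hf, hF⟩, hF1, hg, rfl⟩
  obtain rfl : F = fun x => ∑ i, f i x • z i := funext hF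
  rw [hm.integral_mul_eq hv hr hu Finset.univ (fun i _ => hf i) z hg]
  have h1 := VectorMeasure.norm_integral_le_of_norm_le_const (μ := m) (B := innerSL ℝ)
    (f := fun x => ∑ i, f i x • z i) (C := 1) (.of_forall hF1)
  have h2 : ‖(innerSL ℝ : X →L[ℝ] X →L[ℝ] ℝ)‖ ≤ 1 := norm_innerSL_le ℝ
  rw [← EReal.coe_ennreal_toReal (measure_ne_top _ _), EReal.coe_le_coe_iff]
  refine (le_abs_self _).trans (h1.trans ?_)
  rw [one_mul]
  exact mul_le_of_le_one_left measureReal_nonneg h2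

omit [IsFiniteMeasure ν] [TopologicalSpace.SeparableSpace X] [BorelSpace X] in
lemma le_V {F : X → X} {g : X → ℝ} (hF : IsCb1Field F) (hF1 : ∀ x, ‖F x‖ ≤ 1)
    (hg : IsMStar ν R F g) : ((∫ x, u x * g x ∂ν : ℝ) : EReal) ≤ V ν R u :=
  le_sSup ⟨F, g, hF, hF1, hg, rfl⟩

omit [MeasurableSpace X] [BorelSpace X] [TopologicalSpace.SeparableSpace X] in
lemma isCb1Field_sum {α : Type*} (s : Finset α) {f : α → X → ℝ} (hf : ∀ i ∈ s, IsCb1 (f i))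
    (z : α → X) : IsCb1Field fun x => ∑ i ∈ s, f i x • z i := by
  refine ⟨s.card, fun i => f (s.equivFin.symm i), fun i => z (s.equivFin.symm i),
    fun i => hf _ (s.equivFin.symm i).2, fun x => ?_⟩
  refine (Finset.sum_coe_sort s fun i => f i x • z i).symm.trans ?_
  exact (Equiv.sum_comp s.equivFin.symm fun i : s => f i x • z i).symm

omit [IsFiniteMeasure ν] [TopologicalSpace.SeparableSpace X] [BorelSpace X] in
lemma V_nonneg : 0 ≤ V ν R u := by
  have h := le_V (u := u) (ν := ν) (R := R) (isCb1Field_sum (∅ : Finset ℕ) (f := fun _ _ => 0)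
    (by simp) fun _ => 0) (fun x => by simp) (g := fun _ => 0) (by simpa using IsMStar.zero)
  simpa using h

/-- A finite family of disjoint sets nearly realizing the variation of `m` yields an admissible
field: the indicators are approximated by `C¹_b` functions `g_s` with sum at most `1`, and each is
multiplied by the unit vector in the direction of `m s`. -/
lemma IsBVMeasure.sum_norm_le_V (hv : IsIBPFamily ν R v) (hr : 1 < r)
    (hu : MemLp u (ENNReal.ofReal r) ν) {m : VectorMeasure X X} (hm : IsBVMeasure ν R v u m)
    (P : Finset (Set X)) (hd : (P : Set (Set X)).PairwiseDisjoint id)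
    (hP : ∀ s ∈ P, MeasurableSet s) : ((∑ s ∈ P, ‖m s‖ : ℝ) : EReal) ≤ V ν R u := by
  classical
  have hfin : IsFiniteMeasure m.variation := ⟨hm.1⟩
  have hex : ∀ s : Set X, ∃ f : ℕ → X → ℝ, (∀ n, IsCb1 (f n)) ∧
      (∀ n x, 0 ≤ f n x ∧ f n x ≤ 1) ∧ (s ∈ P →
      ∀ᵐ x ∂m.variation, Tendsto (fun n => f n x) atTop (𝓝 (s.indicator 1 x))) := fun s => by
    by_cases hs : s ∈ P
    · obtain ⟨f, h1, h2, h3⟩ := exists_isCb1_tendsto_indicator m.variation (hP s hs)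
      exact ⟨f, h1, h2, fun _ => h3⟩
    · exact ⟨fun _ _ => 0, fun _ => .const 0, by simp, fun h => absurd h hs⟩
  choose f hf hf01 hlim using hex
  set g : Set X → ℕ → X → ℝ := fun s n x => f s n x * ∏ t ∈ P.erase s, (1 - f t n x) with hg
  have hgC : ∀ s n, IsCb1 (g s n) := fun s n =>
    (hf s n).mul (.prod _ fun t _ => (hf t n).one_sub)
  have hg0 : ∀ s n x, 0 ≤ g s n x := fun s n x =>
    mul_nonneg (hf01 s n x).1 (Finset.prod_nonneg fun t _ => sub_nonneg.2 (hf01 t n x).2)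
  have hg1 : ∀ n x, ∑ s ∈ P, g s n x ≤ 1 := fun n x =>
    sum_mul_prod_one_sub_le_one P (fun s => f s n x) fun s _ => hf01 s n x
  have hglim : ∀ᵐ x ∂m.variation, ∀ s ∈ P,
      Tendsto (fun n => g s n x) atTop (𝓝 (s.indicator 1 x)) := by
    have : ∀ᵐ x ∂m.variation, ∀ s ∈ P,
        Tendsto (fun n => f s n x) atTop (𝓝 (s.indicator 1 x)) :=
      (ae_ball_iff P.countable_toSet).2 fun s hs => hlim s hs
    filter_upwards [this] with x hx s hs
    have h1 : Tendsto (fun n => g s n x) atTop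
        (𝓝 (s.indicator 1 x * ∏ t ∈ P.erase s, (1 - t.indicator 1 x))) :=
      (hx s hs).mul (tendsto_finsetProd _ fun t ht =>
        tendsto_const_nhds.sub (hx t (Finset.mem_of_mem_erase ht)))
    convert h1 using 2
    by_cases hxs : x ∈ s
    · have : ∀ t ∈ P.erase s, 1 - t.indicator (1 : X → ℝ) x = 1 := fun t ht => by
        have hts := Finset.mem_erase.1 ht
        have hxt : x ∉ t := fun h =>
          Set.disjoint_left.1 (hd (by exact_mod_cast hts.2) (by exact_mod_cast hs) hts.1) h hxs
        simp [hxt]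
      rw [Finset.prod_congr rfl this]
      simp
    · simp [hxs]
  set z : Set X → X := fun s => ‖m s‖⁻¹ • m s with hz
  have hz1 : ∀ s, ‖z s‖ ≤ 1 := fun s => by
    rw [hz, norm_smul, norm_inv, norm_norm]
    exact inv_mul_le_one
  have hF1 : ∀ n x, ‖∑ s ∈ P, g s n x • z s‖ ≤ 1 := fun n x => by
    refine (norm_sum_le _ _).trans (le_trans ?_ (hg1 n x))
    refine Finset.sum_le_sum fun s _ => ?_
    rw [norm_smul, Real.norm_of_nonneg (hg0 s n x)]
    exact mul_le_of_le_one_right (hg0 s n x) (hz1 s)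
  have hms : ∀ n, IsMStar ν R (fun x => ∑ s ∈ P, g s n x • z s)
      (fun x => ∑ s ∈ P, mstar R v (g s n) (z s) x) := fun n =>
    .sum P fun s _ => hv.isMStar_smul (hgC s n) (z s)
  have hle : ∀ n, ((∫ᵛ x, ∑ s ∈ P, g s n x • z s ∂[innerSL ℝ; m] : ℝ) : EReal) ≤ V ν R u :=
    fun n => by
      rw [← hm.integral_mul_eq hv hr hu P (fun s _ => hgC s n) z (hms n)]
      exact le_V (isCb1Field_sum P (fun s _ => hgC s n) z) (hF1 n) (hms n)
  have ht : Tendsto (fun n => ∫ᵛ x, ∑ s ∈ P, g s n x • z s ∂[innerSL ℝ; m]) atTop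
      (𝓝 (∫ᵛ x, ∑ s ∈ P, s.indicator (fun _ => z s) x ∂[innerSL ℝ; m])) := by
    refine VectorMeasure.tendsto_integral_filter_of_norm_le_const (.of_forall fun n => ?_)
      ⟨1, .of_forall fun n => .of_forall fun x => hF1 n x⟩ ?_
    · exact Finset.aestronglyMeasurable_fun_sum P fun s _ =>
        ((hgC s n).aestronglyMeasurable _).smul_const _
    · filter_upwards [hglim] with x hx
      refine tendsto_finsetSum _ fun s hs => ?_
      convert (hx s hs).smul_const (z s) using 2
      by_cases hxs : x ∈ s <;> simp [hxs]
  have hval : ∫ᵛ x, ∑ s ∈ P, s.indicator (fun _ => z s) x ∂[innerSL ℝ; m] = ∑ s ∈ P, ‖m s‖ := by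
    rw [VectorMeasure.integral_finsetSum P fun s hs => (integrable_const _).indicator (hP s hs)]
    refine Finset.sum_congr rfl fun s hs => ?_
    rw [VectorMeasure.integral_indicator_const _ (hP s hs), innerSL_apply_apply, hz,
      inner_smul_left, real_inner_self_eq_norm_sq]
    rcases eq_or_ne ‖m s‖ 0 with h | h
    · simp [h]
    · simp only [map_inv₀, conj_trivial]
      field_simp
  rw [hval] at ht
  exact le_of_tendsto ((continuous_coe_real_ereal.tendsto _).comp ht) (.of_forall hle)

lemma IsBVMeasure.variation_eq_V (hv : IsIBPFamily ν R v) (hr : 1 < r)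
    (hu : MemLp u (ENNReal.ofReal r) ν) {m : VectorMeasure X X} (hm : IsBVMeasure ν R v u m) :
    ((m.variation Set.univ : ℝ≥0∞) : EReal) = V ν R u := by
  refine le_antisymm ?_ (hm.V_le hv hr hu)
  rw [← EReal.coe_toENNReal (V_nonneg (ν := ν) (R := R) (u := u)),
    EReal.coe_ennreal_le_coe_ennreal_iff]
  refine le_of_forall_lt fun a ha => ?_
  obtain ⟨P, -, hd, hP, hlt⟩ := VectorMeasure.exists_lt_sum_of_lt_variation m .univ ha
  refine hlt.trans_le ?_
  rw [← EReal.coe_ennreal_le_coe_ennreal_iff, EReal.coe_toENNReal V_nonneg]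
  convert hm.sum_norm_le_V hv hr hu P hd hP using 1
  simp_rw [← ofReal_norm]
  rw [← ENNReal.ofReal_sum_of_nonneg fun s _ => norm_nonneg _, EReal.coe_ennreal_ofReal,
    max_eq_left (Finset.sum_nonneg fun s _ => norm_nonneg _)]

end Variation

/-! ### Dominating measures on compact spaces -/

section CompactDomination

open scoped CompactlySupported

/-- A cone `𝒜` of pairs `(h, c)` with `c ≤ C sup h` is dominated by a finite measure: `c ≤ ∫ h dμ`.
The functional is produced by the M. Riesz extension theorem and represented by the
Riesz–Markov–Kakutani theorem. -/
lemma exists_measure_of_cone {K : Type*} [TopologicalSpace K] [CompactSpace K] [T2Space K]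
    [MeasurableSpace K] [BorelSpace K] [Nonempty K] (𝒜 : PointedCone ℝ (C(K, ℝ) × ℝ)) (C : ℝ)
    (h𝒜 : ∀ p ∈ 𝒜, ∀ M : ℝ, (∀ y, p.1 y ≤ M) → p.2 ≤ C * M) :
    ∃ μ : Measure K, IsFiniteMeasure μ ∧ ∀ p ∈ 𝒜, p.2 ≤ ∫ y, p.1 y ∂μ := by
  obtain ⟨y₀⟩ := ‹Nonempty K›
  let s : PointedCone ℝ (C(K, ℝ) × ℝ) :=
    { carrier := {q | ∃ p ∈ 𝒜, (∀ y, p.1 y ≤ q.1 y) ∧ q.2 ≤ p.2}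
      add_mem' := by
        rintro a b ⟨p, hp, h1, h2⟩ ⟨p', hp', h1', h2'⟩
        exact ⟨p + p', 𝒜.add_mem hp hp', fun y => add_le_add (h1 y) (h1' y), add_le_add h2 h2'⟩
      zero_mem' := ⟨0, 𝒜.zero_mem, fun y => le_rfl, le_rfl⟩
      smul_mem' := by
        rintro c a ⟨p, hp, h1, h2⟩
        exact ⟨c • p, 𝒜.smul_mem c.2 hp, fun y => mul_le_mul_of_nonneg_left (h1 y) c.2,
          mul_le_mul_of_nonneg_left h2 c.2⟩ }
  -- the functional `(a, b) ↦ C a - b` on pairs whose first entry is a constant function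
  let D : Submodule ℝ (C(K, ℝ) × ℝ) :=
    { carrier := {q | ∀ y, q.1 y = q.1 y₀}
      add_mem' := fun {a b} ha hb y => by
        change a.1 y + b.1 y = a.1 y₀ + b.1 y₀
        rw [ha y, hb y]
      zero_mem' := fun y => rfl
      smul_mem' := fun c a ha y => by
        change c * a.1 y = c * a.1 y₀
        rw [ha y] }
  let e : C(K, ℝ) × ℝ →ₗ[ℝ] ℝ :=
    { toFun := fun q => C * q.1 y₀ - q.2
      map_add' := fun a b => by
        change C * (a.1 y₀ + b.1 y₀) - (a.2 + b.2) = _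
        ring
      map_smul' := fun c a => by
        change C * (c * a.1 y₀) - c * a.2 = c * (C * a.1 y₀ - a.2)
        ring }
  obtain ⟨g, hgf, hgs⟩ := riesz_extension s ⟨D, e.comp D.subtype⟩
    (by
      rintro ⟨q, hq⟩ ⟨p, hp, h1, h2⟩
      have := h𝒜 p hp (q.1 y₀) fun y => (h1 y).trans_eq (hq y)
      change 0 ≤ C * q.1 y₀ - q.2
      linarith)
    (by
      rintro ⟨h, c⟩
      refine ⟨⟨(ContinuousMap.const K ‖h‖, -c), fun y => rfl⟩, 0, 𝒜.zero_mem, fun y => ?_, ?_⟩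
      · change 0 ≤ ‖h‖ + h y
        have := (abs_le.1 (h.norm_coe_le_norm y)).1
        linarith
      · change -c + c ≤ 0
        linarith)
  let Λ : C_c(K, ℝ) →ₚ[ℝ] ℝ := PositiveLinearMap.mk₀
    { toFun := fun h => g (h.toContinuousMap, 0)
      map_add' := fun a b => by
        rw [← map_add]
        congr 1
        ext <;> simp
      map_smul' := fun c a => by
        rw [RingHom.id_apply, ← map_smul]
        congr 1
        ext <;> simp }
    fun h hh => hgs _ ⟨0, 𝒜.zero_mem, fun y => hh y, le_rfl⟩
  refine ⟨RealRMK.rieszMeasure Λ, inferInstance, fun p hp => ?_⟩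
  have h1 := RealRMK.integral_rieszMeasure Λ
    (CompactlySupportedContinuousMap.continuousMapEquiv p.1)
  have h2 : g (p.1, 0) = ∫ y, p.1 y ∂(RealRMK.rieszMeasure Λ) := h1.symm
  have h3 : 0 ≤ g p := hgs p ⟨p, hp, fun y => le_rfl, le_rfl⟩
  have h4 : g (0, p.2) = -p.2 := by
    have := hgf ⟨(0, p.2), fun y => rfl⟩
    rw [this]
    change C * 0 - p.2 = _
    ring
  have h5 : g p = g (p.1, 0) + g (0, p.2) := by
    rw [← map_add]
    simp
  linarith

end CompactDomination

/-! ### The coordinate compactification of a Hilbert space -/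

section CoordinateCompactification

section Compactification

variable {X : Type*} [NormedAddCommGroup X] [InnerProductSpace ℝ X] {ι : Type*}

lemma norm_sum_smul_sq {b : ι → X} (hb : Orthonormal ℝ b) (S : Finset ι) (a : ι → ℝ) :
    ‖∑ i ∈ S, a i • b i‖ ^ 2 = ∑ i ∈ S, a i ^ 2 := by
  rw [← real_inner_self_eq_norm_sq, hb.inner_sum]
  simp [sq]

lemma countable_of_orthonormal [TopologicalSpace.SeparableSpace X] {b : ι → X}
    (hb : Orthonormal ℝ b) : Countable ι := by
  have hd : ∀ i j, i ≠ j → 1 ≤ dist (b i) (b j) := fun i j hij => by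
    have h := norm_sub_sq_real (b i) (b j)
    rw [hb.inner_eq_zero hij, hb.norm_eq_one, hb.norm_eq_one] at h
    rw [dist_eq_norm]
    nlinarith [norm_nonneg (b i - b j)]
  have h : (Set.univ : Set ι).PairwiseDisjoint fun i => Metric.ball (b i) (1 / 2) :=
    fun i _ j _ hij => Metric.ball_disjoint_ball (by have := hd i j hij; linarith)
  exact Set.countable_univ_iff.1 <| h.countable_of_isOpen (fun i _ => Metric.isOpen_ball)
    fun i _ => ⟨b i, Metric.mem_ball_self (by norm_num)⟩

/-- The finite rank projection `x ↦ ∑ i ∈ S, ⟨b i, x⟩ b i`. -/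
def proj (b : ι → X) (S : Finset ι) : X →L[ℝ] X := ∑ i ∈ S, (innerSL ℝ (b i)).smulRight (b i)

lemma proj_apply (b : ι → X) (S : Finset ι) (x : X) :
    proj b S x = ∑ i ∈ S, inner ℝ (b i) x • b i := by
  simp [proj]

lemma norm_proj_le {b : ι → X} (hb : Orthonormal ℝ b) (S : Finset ι) : ‖proj b S‖ ≤ 1 := by
  refine ContinuousLinearMap.opNorm_le_bound _ zero_le_one fun x => ?_
  rw [one_mul, ← sq_le_sq₀ (norm_nonneg _) (norm_nonneg _), proj_apply, norm_sum_smul_sq hb]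
  simpa using hb.sum_inner_products_le x (s := S)

lemma tendsto_proj (b : HilbertBasis ι ℝ X) (x : X) :
    Tendsto (fun S => proj b S x) atTop (𝓝 x) := by
  have := b.hasSum_repr x
  simp_rw [b.repr_apply_apply] at this
  simpa only [HasSum, SummationFilter.unconditional_filter, proj_apply] using this

/-- The embedding of `X` into the compact space `ι → [-∞, ∞]` given by the coordinates in the
basis `b`. -/
def coords (b : ι → X) (x : X) : ι → EReal := fun i => ((inner ℝ (b i) x : ℝ) : EReal)

lemma continuous_coords (b : ι → X) : Continuous (coords b) :=
  continuous_pi fun _ => continuous_coe_real_ereal.comp (continuous_const.inner continuous_id)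

lemma injective_coords (b : HilbertBasis ι ℝ X) : Function.Injective (coords b) := fun x y h => by
  have : ∀ i, inner ℝ (b i) x = inner ℝ (b i) y := fun i => EReal.coe_injective (congrFun h i)
  apply b.repr.injective
  ext i
  rw [b.repr_apply_apply, b.repr_apply_apply, this]

open scoped Classical in
/-- The function on `ι → [-∞, ∞]` that extends `H ∘ proj b S` by `0` to the points which have an
infinite coordinate in `S`. -/
def cylinder (b : ι → X) (H : X → ℝ) (S : Finset ι) (y : ι → EReal) : ℝ :=
  if ∀ i ∈ S, y i ≠ ⊤ ∧ y i ≠ ⊥ then H (∑ i ∈ S, (y i).toReal • b i) else 0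

lemma cylinder_coords (b : ι → X) (H : X → ℝ) (S : Finset ι) (x : X) :
    cylinder b H S (coords b x) = H (proj b S x) := by
  rw [cylinder, if_pos fun i _ => ⟨EReal.coe_ne_top _, EReal.coe_ne_bot _⟩, proj_apply]
  rfl

lemma norm_cylinder_le (b : ι → X) {H : X → ℝ} {C : ℝ} (hC : ∀ x, ‖H x‖ ≤ C) (S : Finset ι)
    (y : ι → EReal) : ‖cylinder b H S y‖ ≤ C := by
  rw [cylinder]
  split_ifs
  · exact hC _
  · simpa using (norm_nonneg _).trans (hC 0)

lemma abs_le_norm_sum_smul {b : ι → X} (hb : Orthonormal ℝ b) {S : Finset ι} {i : ι} (hi : i ∈ S)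
    (a : ι → ℝ) : |a i| ≤ ‖∑ i ∈ S, a i • b i‖ := by
  rw [← sq_le_sq₀ (abs_nonneg _) (norm_nonneg _), norm_sum_smul_sq hb, sq_abs]
  exact Finset.single_le_sum (f := fun i => a i ^ 2) (fun j _ => sq_nonneg _) hi

/-- A function of bounded support yields continuous cylinder functions: near a point with an
infinite coordinate, the projected point leaves every ball. -/
lemma continuous_cylinder {b : ι → X} (hb : Orthonormal ℝ b) {H : X → ℝ} (hH : Continuous H) {r : ℝ}
    (hr : ∀ x, r < ‖x‖ → H x = 0) (S : Finset ι) : Continuous (cylinder b H S) := by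
  refine continuous_iff_continuousAt.2 fun y => ?_
  by_cases hy : ∀ i ∈ S, y i ≠ ⊤ ∧ y i ≠ ⊥
  · have hfin : ∀ᶠ y' in 𝓝 y, ∀ i ∈ S, y' i ≠ ⊤ ∧ y' i ≠ ⊥ := by
      refine (Filter.eventually_all_finset S).2 fun i hi => ?_
      have hc : ContinuousAt (fun y' : ι → EReal => y' i) y := (continuous_apply i).continuousAt
      exact (hc.eventually_ne (hy i hi).1).and (hc.eventually_ne (hy i hi).2)
    have hc : ContinuousAt (fun y' : ι → EReal => H (∑ i ∈ S, (y' i).toReal • b i)) y := by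
      refine hH.continuousAt.comp (tendsto_finsetSum _ fun i hi => ?_)
      have hi' : Tendsto (fun y' : ι → EReal => y' i) (𝓝 y) (𝓝 (y i)) :=
        (continuous_apply i).continuousAt
      exact ((EReal.tendsto_toReal (hy i hi).1 (hy i hi).2).comp hi').smul_const (b i)
    refine hc.congr ?_
    filter_upwards [hfin] with y' hy'
    rw [cylinder, if_pos hy']
  · have hzero : ∀ᶠ y' in 𝓝 y, cylinder b H S y' = 0 := by
      push Not at hy
      obtain ⟨i, hi, hyi⟩ := hy
      have hc : ContinuousAt (fun y' : ι → EReal => y' i) y := (continuous_apply i).continuousAt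
      have hlarge : ∀ᶠ y' in 𝓝 y, (r : EReal) < y' i ∨ y' i < ((-r : ℝ) : EReal) := by
        by_cases htop : y i = ⊤
        · exact (hc.eventually_const_lt ((EReal.coe_lt_top r).trans_eq htop.symm)).mono
            fun _ => Or.inl
        · exact (hc.eventually_lt_const ((hyi htop).trans_lt (EReal.bot_lt_coe _))).mono
            fun _ => Or.inr
      filter_upwards [hlarge] with y' hy'
      rw [cylinder]
      split_ifs with hfin
      · refine hr _ (lt_of_lt_of_le ?_ (abs_le_norm_sum_smul hb hi fun i => (y' i).toReal))
        rw [← EReal.coe_toReal (hfin i hi).1 (hfin i hi).2, EReal.coe_lt_coe_iff,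
          EReal.coe_lt_coe_iff] at hy'
        rcases hy' with h | h
        · exact h.trans_le (le_abs_self _)
        · exact lt_of_lt_of_le (by linarith) (neg_le_abs _)
      · rfl
    refine ContinuousAt.congr (f := fun _ => 0) continuousAt_const ?_
    filter_upwards [hzero] with y' hy' using hy'.symm

/-- Cylinder functions of `H` converge pointwise to `H` on the image of `X`, and to `0` elsewhere:
a point outside the image has an infinite coordinate, or its coordinates are not square summable. -/
lemma tendsto_cylinder [CompleteSpace X] (b : HilbertBasis ι ℝ X) {H : X → ℝ} (hH : Continuous H)
    {r : ℝ} (hr : ∀ x, r < ‖x‖ → H x = 0) (y : ι → EReal) :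
    Tendsto (fun S => cylinder b H S y) atTop (𝓝 (Function.extend (coords b) H 0 y)) := by
  by_cases hy : ∃ x, coords b x = y
  · obtain ⟨x, rfl⟩ := hy
    rw [(injective_coords b).extend_apply]
    simp_rw [cylinder_coords]
    exact (hH.tendsto x).comp (tendsto_proj b x)
  rw [Function.extend_apply' _ _ _ hy, Pi.zero_apply]
  refine tendsto_const_nhds.congr' (EventuallyEq.symm ?_)
  by_cases hfin : ∀ i, y i ≠ ⊤ ∧ y i ≠ ⊥
  · have hns : ¬ Summable fun i => (y i).toReal ^ 2 := fun hs => hy <| by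
      have hmem : Memℓp (fun i => (y i).toReal) 2 := memℓp_gen (by simpa using hs)
      refine ⟨b.repr.symm ⟨_, hmem⟩, funext fun i => ?_⟩
      rw [coords, ← b.repr_apply_apply, LinearIsometryEquiv.apply_symm_apply]
      exact EReal.coe_toReal (hfin i).1 (hfin i).2
    have hbig : ∃ S₀ : Finset ι, r ^ 2 < ∑ i ∈ S₀, (y i).toReal ^ 2 := by
      by_contra! h
      exact hns (summable_of_sum_le (fun i => sq_nonneg _) h)
    obtain ⟨S₀, hS₀⟩ := hbig
    filter_upwards [eventually_ge_atTop S₀] with S hS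
    rw [cylinder, if_pos fun i _ => hfin i]
    refine hr _ (lt_of_pow_lt_pow_left₀ 2 (norm_nonneg _) ?_)
    rw [norm_sum_smul_sq b.orthonormal]
    exact hS₀.trans_le (Finset.sum_le_sum_of_subset_of_nonneg hS fun i _ _ => sq_nonneg _)
  · push Not at hfin
    obtain ⟨i, hi⟩ := hfin
    filter_upwards [eventually_ge_atTop {i}] with S hS
    rw [cylinder, if_neg]
    exact fun h => (h i (Finset.singleton_subset_iff.1 hS)).2
      (hi (h i (Finset.singleton_subset_iff.1 hS)).1)

end Compactification

end CoordinateCompactification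

/-! ### A measure that dominates the functional -/

section DominatingMeasure

variable {X : Type*} [NormedAddCommGroup X] [InnerProductSpace ℝ X] [CompleteSpace X]

lemma IsCb1Field.add {F F' : X → X} (hF : IsCb1Field F) (hF' : IsCb1Field F') :
    IsCb1Field fun x => F x + F' x := by
  obtain ⟨n, f, z, hf, hFz⟩ := hF
  obtain ⟨n', f', z', hf', hFz'⟩ := hF'
  have h := isCb1Field_sum (Finset.univ : Finset (Fin n ⊕ Fin n')) (f := Sum.elim f f')
    (fun i _ => by rcases i with i | i; exacts [hf i, hf' i]) (Sum.elim z z')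
  convert h using 2 with x
  simp [hFz, hFz']

lemma IsCb1Field.const_smul {F : X → X} (hF : IsCb1Field F) (c : ℝ) :
    IsCb1Field fun x => c • F x := by
  obtain ⟨n, f, z, hf, hFz⟩ := hF
  exact ⟨n, fun i x => c * f i x, z, fun i => (hf i).const_mul c,
    fun x => by simp [hFz, Finset.smul_sum, mul_smul]⟩

lemma isCb1Field_zero : IsCb1Field fun _ : X => (0 : X) := by
  simpa using isCb1Field_sum (X := X) (∅ : Finset ℕ) (f := fun _ _ => 0) (by simp) fun _ => 0

lemma IsCb1Field.continuous {F : X → X} (hF : IsCb1Field F) : Continuous F := by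
  obtain ⟨n, f, z, hf, hFz⟩ := hF
  rw [funext hFz]
  exact continuous_finsetSum _ fun i _ => (hf i).continuous.smul continuous_const

lemma IsCb1Field.exists_bound {F : X → X} (hF : IsCb1Field F) : ∃ C : ℝ, ∀ x, ‖F x‖ ≤ C := by
  obtain ⟨n, f, z, hf, hFz⟩ := hF
  choose C _ hC using fun i => (hf i).exists_bound
  refine ⟨∑ i, C i * ‖z i‖, fun x => ?_⟩
  rw [hFz]
  refine (norm_sum_le _ _).trans (Finset.sum_le_sum fun i _ => ?_)
  rw [norm_smul]
  gcongr
  exact hC i x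

/-- The cutoff `cutoff` rescaled to the ball of radius `n + 1`. -/
def cutoffAt (n : ℕ) (x : X) : ℝ := cutoff (((n : ℝ) + 1)⁻¹ • x)

omit [CompleteSpace X] in
lemma cutoffAt_nonneg (n : ℕ) (x : X) : 0 ≤ cutoffAt n x := cutoff_nonneg _

omit [CompleteSpace X] in
lemma cutoffAt_le_one (n : ℕ) (x : X) : cutoffAt n x ≤ 1 := cutoff_le_one _

omit [CompleteSpace X] in
lemma cutoffAt_eq_one {n : ℕ} {x : X} (hx : ‖x‖ ≤ n + 1) : cutoffAt n x = 1 := by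
  refine cutoff_eq_one ?_
  have hn : (0 : ℝ) < n + 1 := by positivity
  rw [norm_smul, norm_inv, Real.norm_of_nonneg hn.le, inv_mul_le_iff₀ hn]
  linarith

omit [CompleteSpace X] in
lemma cutoffAt_eq_zero {n : ℕ} {x : X} (hx : 2 * ((n : ℝ) + 1) < ‖x‖) : cutoffAt n x = 0 := by
  refine cutoff_eq_zero ?_
  have hn : (0 : ℝ) < n + 1 := by positivity
  have : 2 ≤ ‖((n : ℝ) + 1)⁻¹ • x‖ := by
    rw [norm_smul, norm_inv, Real.norm_of_nonneg hn.le, le_inv_mul_iff₀ hn]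
    linarith
  nlinarith

lemma isCb1_cutoffAt (n : ℕ) : IsCb1 (cutoffAt n : X → ℝ) :=
  isCb1_cutoff.comp_clm (((n : ℝ) + 1)⁻¹ • ContinuousLinearMap.id ℝ X)

lemma exists_fderiv_cutoffAt_bound :
    ∃ D : ℝ, 0 ≤ D ∧ ∀ (n : ℕ) (x : X), ‖fderiv ℝ (cutoffAt n) x‖ ≤ D := by
  obtain ⟨D, hD0, hD⟩ := (isCb1_cutoff (X := X)).exists_fderiv_bound
  refine ⟨D, hD0, fun n x => ?_⟩
  have hn : (1 : ℝ) ≤ n + 1 := by simp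
  have h := isCb1_cutoff.fderiv_comp_clm (((n : ℝ) + 1)⁻¹ • ContinuousLinearMap.id ℝ X) x
  rw [show fderiv ℝ (cutoffAt n) x = _ from h]
  refine (ContinuousLinearMap.opNorm_comp_le _ _).trans ?_
  have h1 : ‖((n : ℝ) + 1)⁻¹ • ContinuousLinearMap.id ℝ X‖ ≤ 1 := by
    rw [norm_smul, norm_inv, Real.norm_of_nonneg (by positivity)]
    exact mul_le_one₀ (inv_le_one_of_one_le₀ hn) (norm_nonneg _) ContinuousLinearMap.norm_id_le
  calc _ ≤ D * 1 := mul_le_mul (hD _) h1 (norm_nonneg _) hD0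
    _ = D := mul_one D

variable [TopologicalSpace.SeparableSpace X] [MeasurableSpace X] [BorelSpace X]
  {ν : Measure X} [IsFiniteMeasure ν] {R : X →L[ℝ] X} {v : X → X → ℝ} {u : X → ℝ} {r : ℝ}

/-- The pairing with `M^*(f z)` is the limit of its values along the truncations of `f`. -/
lemma IsIBPFamily.tendsto_cutoffAt (hv : IsIBPFamily ν R v) (hr : 1 < r)
    (hu : MemLp u (ENNReal.ofReal r) ν) {f : X → ℝ} (hf : IsCb1 f) (z : X) :
    Tendsto (fun n => ∫ x, u x * mstar R v (fun x => cutoffAt n x * f x) z x ∂ν) atTop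
      (𝓝 (∫ x, u x * mstar R v f z x ∂ν)) := by
  obtain ⟨C, hC0, hC⟩ := hf.exists_bound
  obtain ⟨D, hD0, hD⟩ := hf.exists_fderiv_bound
  obtain ⟨E, hE0, hE⟩ := exists_fderiv_cutoffAt_bound (X := X)
  have hone : ∀ (n : ℕ) (x : X), |cutoffAt n x| ≤ 1 := fun n x => by
    rw [abs_of_nonneg (cutoffAt_nonneg n x)]
    exact cutoffAt_le_one n x
  have hev : ∀ x : X, ∀ᶠ n : ℕ in atTop, (fun x => cutoffAt n x * f x) =ᶠ[𝓝 x] f := fun x => by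
    obtain ⟨N, hN⟩ := exists_nat_gt ‖x‖
    filter_upwards [eventually_ge_atTop N] with n hn
    have hlt : ‖x‖ < n + 1 := by
      have : (N : ℝ) ≤ n := by exact_mod_cast hn
      linarith
    filter_upwards [continuous_norm.continuousAt.eventually_lt_const hlt] with y hy
    rw [cutoffAt_eq_one hy.le, one_mul]
  refine hv.tendsto_integral_mul_mstar hr hu (C := 1 * C) (D := 1 * D + C * E)
    (fun n => (isCb1_cutoffAt n).mul hf) z (fun n x => ?_) (fun n x => ?_) (fun x => ?_)
    fun x w => ?_
  · rw [abs_mul]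
    exact mul_le_mul (hone n x) (hC x) (abs_nonneg _) zero_le_one
  · rw [fderiv_fun_mul ((isCb1_cutoffAt n).differentiable x) (hf.differentiable x)]
    refine (norm_add_le _ _).trans ?_
    rw [norm_smul, norm_smul, Real.norm_eq_abs, Real.norm_eq_abs]
    exact add_le_add (mul_le_mul (hone n x) (hD x) (norm_nonneg _) zero_le_one)
      (mul_le_mul (hC x) (hE n x) (norm_nonneg _) hC0)
  · refine tendsto_const_nhds.congr' ?_
    filter_upwards [hev x] with n hn using hn.self_of_nhds.symm
  · refine tendsto_const_nhds.congr' ?_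
    filter_upwards [hev x] with n hn
    rw [hn.fderiv_eq]

/-- The pairing with `M^*(f z)` is the limit of its values along the finite-dimensional
approximations `f ∘ proj b S`. -/
lemma IsIBPFamily.tendsto_proj (hv : IsIBPFamily ν R v) (hr : 1 < r)
    (hu : MemLp u (ENNReal.ofReal r) ν) {ι : Type*} [Countable ι] (b : HilbertBasis ι ℝ X)
    {f : X → ℝ} (hf : IsCb1 f) (z : X) :
    Tendsto (fun S => ∫ x, u x * mstar R v (fun x => f (proj b S x)) z x ∂ν) atTop
      (𝓝 (∫ x, u x * mstar R v f z x ∂ν)) := by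
  obtain ⟨C, hC0, hC⟩ := hf.exists_bound
  obtain ⟨D, hD0, hD⟩ := hf.exists_fderiv_bound
  refine hv.tendsto_integral_mul_mstar hr hu (C := C) (D := D * 1) (fun S => hf.comp_clm _) z
    (fun S x => hC _) (fun S x => ?_) (fun x => ?_) fun x w => ?_
  · rw [hf.fderiv_comp_clm]
    exact (ContinuousLinearMap.opNorm_comp_le _ _).trans
      (mul_le_mul (hD _) (norm_proj_le b.orthonormal S) (norm_nonneg _) hD0)
  · exact (hf.continuous.tendsto x).comp (HilbertBV.tendsto_proj b x)
  · simp_rw [hf.fderiv_comp_clm]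
    have hc : Continuous fun q : X × X => fderiv ℝ f q.1 q.2 :=
      (hf.continuous_fderiv.comp continuous_fst).clm_apply continuous_snd
    exact (hc.tendsto (x, w)).comp
      ((HilbertBV.tendsto_proj b x).prodMk_nhds (HilbertBV.tendsto_proj b w))

/-- If the functional `F ↦ ∫ u M^*F` is bounded by `C` on the unit ball of the sup norm, then it is
dominated on the compactification by a finite measure, for all fields whose norm extends. -/
lemma exists_measure_of_bounded {ι : Type*} [Countable ι] (b : ι → X) (hr : 1 < r)
    (hu : MemLp u (ENNReal.ofReal r) ν) {C : ℝ}
    (hC : ∀ F g, IsCb1Field F → (∀ x, ‖F x‖ ≤ 1) → IsMStar ν R F g → ∫ x, u x * g x ∂ν ≤ C) :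
    ∃ μ : Measure (ι → EReal), IsFiniteMeasure μ ∧ ∀ (F : X → X) (g : X → ℝ)
      (h : C(ι → EReal, ℝ)), IsCb1Field F → IsMStar ν R F g → (∀ x, ‖F x‖ ≤ h (coords b x)) →
        ∫ x, u x * g x ∂ν ≤ ∫ y, h y ∂μ := by
  let 𝒜 : PointedCone ℝ (C(ι → EReal, ℝ) × ℝ) :=
    { carrier := {p | ∃ F g, IsCb1Field F ∧ IsMStar ν R F g ∧ ∫ x, u x * g x ∂ν = p.2 ∧
        ∀ x, ‖F x‖ ≤ p.1 (coords b x)}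
      add_mem' := by
        rintro p p' ⟨F, g, hF, hg, hc, hle⟩ ⟨F', g', hF', hg', hc', hle'⟩
        refine ⟨_, _, hF.add hF', hg.add hg', ?_, fun x =>
          (norm_add_le _ _).trans (add_le_add (hle x) (hle' x))⟩
        simp_rw [mul_add]
        rw [integral_add (hg.integrable_mul hr hu) (hg'.integrable_mul hr hu), hc, hc']
        rfl
      zero_mem' := ⟨_, _, isCb1Field_zero, IsMStar.zero, by simp, by simp⟩
      smul_mem' := by
        rintro c p ⟨F, g, hF, hg, hc, hle⟩
        refine ⟨_, _, hF.const_smul c, hg.const_smul c, ?_, fun x => ?_⟩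
        · simp_rw [mul_left_comm _ (c : ℝ)]
          rw [integral_const_mul, hc]
          rfl
        · rw [norm_smul, Real.norm_of_nonneg c.2]
          exact mul_le_mul_of_nonneg_left (hle x) c.2 }
  obtain ⟨μ, hμ, hμ𝒜⟩ := exists_measure_of_cone 𝒜 C <| by
    rintro p ⟨F, g, hF, hg, hc, hle⟩ M hM
    have hFM : ∀ x, ‖F x‖ ≤ M := fun x => (hle x).trans (hM _)
    rcases ((norm_nonneg _).trans (hFM 0)).eq_or_lt with rfl | hM0
    · have hF0 : F = fun _ => 0 := funext fun x => norm_le_zero_iff.1 (hFM x)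
      subst hF0
      rw [← hc, hg.integral_mul_eq u IsMStar.zero]
      simp
    · have h := hC _ _ (hF.const_smul M⁻¹) (fun x => ?_) (hg.const_smul M⁻¹)
      · simp_rw [mul_left_comm _ M⁻¹] at h
        rw [integral_const_mul, hc, inv_mul_le_iff₀ hM0] at h
        linarith
      · rw [norm_smul, norm_inv, Real.norm_of_nonneg hM0.le, inv_mul_le_iff₀ hM0, mul_one]
        exact hFM x
  exact ⟨μ, hμ, fun F g h hF hg hle => hμ𝒜 (h, _) ⟨F, g, hF, hg, rfl, hle⟩⟩

/-- If the functional `F ↦ ∫ u M^*F` is bounded for the sup norm, then it is dominated by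
`F ↦ ∫ ‖F‖ dμ` for a finite Borel measure `μ` on `X`. The measure on the compactification need not
be carried by `X`, but its part outside `X` is not seen by fields of the form
`(cutoff • F) ∘ proj b S` in the limit. -/
lemma IsIBPFamily.exists_dominating_measure (hv : IsIBPFamily ν R v) (hr : 1 < r)
    (hu : MemLp u (ENNReal.ofReal r) ν) {C : ℝ}
    (hC : ∀ F g, IsCb1Field F → (∀ x, ‖F x‖ ≤ 1) → IsMStar ν R F g → ∫ x, u x * g x ∂ν ≤ C) :
    ∃ μ : Measure X, IsFiniteMeasure μ ∧ ∀ F g, IsCb1Field F → IsMStar ν R F g →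
      ∫ x, u x * g x ∂ν ≤ ∫ x, ‖F x‖ ∂μ := by
  have : SecondCountableTopology X := UniformSpace.secondCountable_of_separable X
  obtain ⟨w, b, -⟩ := exists_hilbertBasis ℝ X
  have : Countable w := countable_of_orthonormal b.orthonormal
  obtain ⟨μ, hμ, hdom⟩ := exists_measure_of_bounded (R := R) b hr hu hC
  have he : MeasurableEmbedding (coords b) :=
    (continuous_coords b).measurableEmbedding (injective_coords b)
  have hfin : IsFiniteMeasure (μ.comap (coords b)) := ⟨by
    rw [he.comap_apply]
    exact measure_lt_top _ _⟩
  refine ⟨μ.comap (coords b), hfin, fun F g hF hg => ?_⟩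
  have hF' := hF
  obtain ⟨n, f, z, hf, hFz⟩ := hF'
  obtain rfl : F = fun x => ∑ i, f i x • z i := funext hFz
  -- integrals of limits of cylinder functions
  have hext : ∀ H : X → ℝ, ∫ y, Function.extend (coords b) H 0 y ∂μ =
      ∫ x, H x ∂(μ.comap (coords b)) := fun H => by
    calc ∫ y, Function.extend (coords b) H 0 y ∂μ
        = ∫ y in Set.range (coords b), Function.extend (coords b) H 0 y ∂μ :=
          (setIntegral_eq_integral_of_forall_compl_eq_zero fun y hy => by
            rw [Function.extend_apply' _ _ _ hy, Pi.zero_apply]).symm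
      _ = ∫ x, H x ∂(μ.comap (coords b)) := by
          rw [← he.map_comap, he.integral_map]
          simp_rw [he.injective.extend_apply]
  have hcut : ∀ k : ℕ, ∑ i, ∫ x, u x * mstar R v (fun x => cutoffAt k x * f i x) (z i) x ∂ν ≤
      ∫ x, ‖∑ i, f i x • z i‖ ∂(μ.comap (coords b)) := fun k => by
    have hfk : ∀ i, IsCb1 (fun x => cutoffAt k x * f i x) := fun i => (isCb1_cutoffAt k).mul (hf i)
    have hG : IsCb1Field fun x => ∑ i, (cutoffAt k x * f i x) • z i :=
      isCb1Field_sum Finset.univ (fun i _ => hfk i) z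
    set H : X → ℝ := fun x => ‖∑ i, (cutoffAt k x * f i x) • z i‖ with hH
    have hHc : Continuous H := hG.continuous.norm
    have hHr : ∀ x, 2 * ((k : ℝ) + 1) < ‖x‖ → H x = 0 := fun x hx => by
      simp [hH, cutoffAt_eq_zero hx]
    obtain ⟨A, hA⟩ := hG.exists_bound
    have hle : ∀ S, ∑ i, ∫ x, u x * mstar R v (fun x => cutoffAt k (proj b S x) *
        f i (proj b S x)) (z i) x ∂ν ≤ ∫ y, cylinder b H S y ∂μ := fun S => by
      have hfS := fun i => (hfk i).comp_clm (proj b S)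
      have h1 := hdom _ _ ⟨_, continuous_cylinder b.orthonormal hHc hHr S⟩
        (isCb1Field_sum Finset.univ (fun i _ => hfS i) z) (hv.isMStar_sum hfS z)
        fun x => (cylinder_coords b H S x).ge
      simp_rw [Finset.mul_sum] at h1
      rwa [integral_finsetSum _ fun i _ => (hv.isMStar_smul (hfS i) (z i)).integrable_mul hr hu]
        at h1
    have hlim : Tendsto (fun S => ∫ y, cylinder b H S y ∂μ) atTop
        (𝓝 (∫ y, Function.extend (coords b) H 0 y ∂μ)) :=
      tendsto_integral_filter_of_dominated_convergence (fun _ => A)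
        (.of_forall fun S =>
          (continuous_cylinder b.orthonormal hHc hHr S).aestronglyMeasurable)
        (.of_forall fun S => .of_forall fun y =>
          norm_cylinder_le b (fun x => (norm_norm _).trans_le (hA x)) S y)
        (integrable_const _) (.of_forall fun y => tendsto_cylinder b hHc hHr y)
    have h2 := le_of_tendsto_of_tendsto'
      (tendsto_finsetSum _ fun i _ => hv.tendsto_proj hr hu b (hfk i) (z i)) hlim hle
    rw [hext] at h2
    refine h2.trans (integral_mono_of_nonneg (.of_forall fun x => norm_nonneg _) ?_
      (.of_forall fun x => ?_))
    · obtain ⟨B, hB⟩ := hF.exists_bound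
      exact (Integrable.of_bound hF.continuous.aestronglyMeasurable B (.of_forall hB)).norm
    · simp_rw [hH, mul_smul, ← Finset.smul_sum]
      rw [norm_smul, Real.norm_of_nonneg (cutoffAt_nonneg k x)]
      exact mul_le_of_le_one_left (norm_nonneg _) (cutoffAt_le_one k x)
  rw [hg.integral_mul_eq u (hv.isMStar_sum hf z)]
  simp_rw [Finset.mul_sum]
  rw [integral_finsetSum _ fun i _ => (hv.isMStar_smul (hf i) (z i)).integrable_mul hr hu]
  exact le_of_tendsto' (tendsto_finsetSum _ fun i _ => hv.tendsto_cutoffAt hr hu (hf i) (z i)) hcut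

end DominatingMeasure

/-! ### Existence of a BV measure -/

section Existence

/-- A linear functional `ℓ` on a vector space `W` with `|ℓ w| ≤ C ‖T w‖`, where `T` maps `W` to a
Hilbert space, is of the form `w ↦ ⟨σ, T w⟩`. -/
lemma exists_inner_representation {W H : Type*} [AddCommGroup W] [Module ℝ W]
    [NormedAddCommGroup H] [InnerProductSpace ℝ H] [CompleteSpace H] (T : W →ₗ[ℝ] H) (ℓ : W →ₗ[ℝ] ℝ)
    {C : ℝ} (h : ∀ w, |ℓ w| ≤ C * ‖T w‖) : ∃ σ : H, ∀ w, ℓ w = inner ℝ σ (T w) := by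
  obtain ⟨s, hs⟩ := T.rangeRestrict.exists_rightInverse_of_surjective T.range_rangeRestrict
  have hTs : ∀ y : LinearMap.range T, T (s y) = y := fun y =>
    congrArg Subtype.val (LinearMap.congr_fun hs y)
  have hℓs : ∀ w, ℓ (s (T.rangeRestrict w)) = ℓ w := fun w => by
    have := h (s (T.rangeRestrict w) - w)
    rw [map_sub, map_sub, hTs, LinearMap.codRestrict_apply, sub_self, norm_zero, mul_zero] at this
    exact sub_eq_zero.1 (abs_nonpos_iff.1 this)
  let f : StrongDual ℝ (LinearMap.range T) := (ℓ ∘ₗ s).mkContinuous C fun y => by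
    simpa [hTs] using h (s y)
  obtain ⟨g, hg, -⟩ := exists_extension_norm_eq (LinearMap.range T) f
  refine ⟨(InnerProductSpace.toDual ℝ H).symm g, fun w => ?_⟩
  rw [InnerProductSpace.toDual_symm_apply, ← hℓs w]
  exact (hg (T.rangeRestrict w)).symm

lemma exists_real_exponent {α : Type*} [MeasurableSpace α] {ν : Measure α} [IsFiniteMeasure ν]
    {u : α → ℝ} {p : ℝ≥0∞} (hp : 1 < p) (hu : MemLp u p ν) :
    ∃ r : ℝ, 1 < r ∧ MemLp u (ENNReal.ofReal r) ν := by
  rcases eq_or_ne p ∞ with rfl | hp'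
  · exact ⟨2, one_lt_two, hu.mono_exponent le_top⟩
  · refine ⟨p.toReal, ?_, by rwa [ENNReal.ofReal_toReal hp']⟩
    rwa [← ENNReal.toReal_one, ENNReal.toReal_lt_toReal ENNReal.one_ne_top hp']

variable {X : Type*} [NormedAddCommGroup X] [InnerProductSpace ℝ X] [CompleteSpace X]

variable (X) in
/-- The vector space of `C¹_b` fields. -/
def fieldSpace : Submodule ℝ (X → X) where
  carrier := {F | IsCb1Field F}
  add_mem' := IsCb1Field.add
  zero_mem' := isCb1Field_zero
  smul_mem' := fun c _ hF => hF.const_smul c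

variable [TopologicalSpace.SeparableSpace X] [MeasurableSpace X] [BorelSpace X]
  {ν : Measure X} [IsFiniteMeasure ν] {R : X →L[ℝ] X} {v : X → X → ℝ} {u : X → ℝ} {r : ℝ}

lemma IsCb1Field.memLp {F : X → X} (hF : IsCb1Field F) (μ : Measure X) [IsFiniteMeasure μ]
    (p : ℝ≥0∞) : MemLp F p μ := by
  have : SecondCountableTopology X := UniformSpace.secondCountable_of_separable X
  obtain ⟨C, hC⟩ := hF.exists_bound
  exact .of_bound hF.continuous.aestronglyMeasurable C (.of_forall hC)

lemma IsIBPFamily.exists_isMStar (hv : IsIBPFamily ν R v) {F : X → X} (hF : IsCb1Field F) :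
    ∃ g, IsMStar ν R F g := by
  obtain ⟨n, f, z, hf, hFz⟩ := hF
  obtain rfl : F = fun x => ∑ i, f i x • z i := funext hFz
  exact ⟨_, hv.isMStar_sum hf z⟩

/-- The canonical map from `C¹_b` fields to `L²(μ; X)`. -/
lemma exists_linearMap_fieldSpace_Lp (μ : Measure X) [IsFiniteMeasure μ] :
    ∃ T : fieldSpace X →ₗ[ℝ] Lp X 2 μ, ∀ F : fieldSpace X, T F =ᵐ[μ] (F : X → X) :=
  ⟨{  toFun := fun F => (IsCb1Field.memLp F.2 μ 2).toLp F
      map_add' := fun _ _ => MemLp.toLp_add _ _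
      map_smul' := fun _ _ => MemLp.toLp_const_smul _ _ },
    fun F => MemLp.coeFn_toLp (IsCb1Field.memLp F.2 μ 2)⟩

/-- The functional `F ↦ ∫ u M^*F` is represented by a density `σ ∈ L²(μ; X)`, where `μ` is a
dominating measure: by the Cauchy–Schwarz inequality `∫ ‖F‖ dμ ≤ μ(X)^{1/2} ‖F‖_{L²(μ)}`. -/
lemma IsIBPFamily.exists_density (hv : IsIBPFamily ν R v) (hr : 1 < r)
    (hu : MemLp u (ENNReal.ofReal r) ν) {μ : Measure X} [IsFiniteMeasure μ]
    (hμ : ∀ F g, IsCb1Field F → IsMStar ν R F g → ∫ x, u x * g x ∂ν ≤ ∫ x, ‖F x‖ ∂μ) :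
    ∃ σ : X → X, Integrable σ μ ∧ ∀ F g, IsCb1Field F → IsMStar ν R F g →
      ∫ x, u x * g x ∂ν = ∫ x, inner ℝ (σ x) (F x) ∂μ := by
  choose M hM using fun F : fieldSpace X => hv.exists_isMStar F.2
  let ℓ : fieldSpace X →ₗ[ℝ] ℝ :=
    { toFun := fun F => ∫ x, u x * M F x ∂ν
      map_add' := fun F F' => by
        rw [(hM (F + F')).integral_mul_eq u ((hM F).add (hM F'))]
        simp_rw [mul_add]
        exact integral_add ((hM F).integrable_mul hr hu) ((hM F').integrable_mul hr hu)
      map_smul' := fun c F => by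
        rw [(hM (c • F)).integral_mul_eq u ((hM F).const_smul c)]
        simp_rw [mul_left_comm _ c]
        exact integral_const_mul _ _ }
  obtain ⟨T, hT⟩ := exists_linearMap_fieldSpace_Lp (X := X) μ
  set κ : ℝ := (μ Set.univ ^ (1 / (1 : ℝ≥0∞).toReal - 1 / (2 : ℝ≥0∞).toReal)).toReal with hκ
  have hbound : ∀ F : fieldSpace X, ∫ x, ‖(F : X → X) x‖ ∂μ ≤ κ * ‖T F‖ := fun F => by
    have hF := IsCb1Field.memLp F.2 μ 2
    have h1 := eLpNorm_le_eLpNorm_mul_rpow_measure_univ (μ := μ) (p := 1) (q := 2)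
      one_le_two hF.1
    rw [integral_norm_eq_lintegral_enorm hF.1, ← eLpNorm_one_eq_lintegral_enorm]
    have h2 : ‖T F‖ = (eLpNorm (F : X → X) 2 μ).toReal := by
      rw [Lp.norm_def, eLpNorm_congr_ae (hT F)]
    rw [h2, hκ, mul_comm, ← ENNReal.toReal_mul]
    refine ENNReal.toReal_mono (ENNReal.mul_ne_top hF.2.ne ?_) h1
    exact ENNReal.rpow_ne_top_of_nonneg (by norm_num) (measure_ne_top _ _)
  have hle : ∀ F, ℓ F ≤ κ * ‖T F‖ := fun F => (hμ F _ F.2 (hM F)).trans (hbound F)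
  obtain ⟨σ, hσ⟩ := exists_inner_representation T ℓ (C := κ) fun F => abs_le.2
    ⟨by have := hle (-F); rw [map_neg, map_neg, norm_neg] at this; linarith, hle F⟩
  refine ⟨σ, (Lp.memLp σ).integrable one_le_two, fun F g hF hg => ?_⟩
  rw [hg.integral_mul_eq u (hM ⟨F, hF⟩)]
  refine (hσ ⟨F, hF⟩).trans ?_
  rw [L2.inner_def]
  refine integral_congr_ae ?_
  filter_upwards [hT ⟨F, hF⟩] with x hx
  rw [hx]

/-- If `V(u)` is finite, then `σ μ` is a BV measure, where `μ` is a dominating measure and `σ` is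
the density that represents the functional. -/
lemma IsIBPFamily.exists_isBVMeasure (hv : IsIBPFamily ν R v) (hr : 1 < r)
    (hu : MemLp u (ENNReal.ofReal r) ν) (hV : V ν R u < ⊤) :
    ∃ m : VectorMeasure X X, IsBVMeasure ν R v u m := by
  have : SecondCountableTopology X := UniformSpace.secondCountable_of_separable X
  have hV' : V ν R u = ((V ν R u).toReal : EReal) :=
    (EReal.coe_toReal hV.ne (V_nonneg.trans_lt' EReal.bot_lt_zero).ne').symm
  obtain ⟨μ, hμfin, hμ⟩ := hv.exists_dominating_measure hr hu (C := (V ν R u).toReal)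
    fun F g hF hF1 hg => by
      rw [← EReal.coe_le_coe_iff, ← hV']
      exact le_V hF hF1 hg
  obtain ⟨σ, hσ, hrep⟩ := hv.exists_density hr hu hμ
  refine ⟨μ.withDensityᵥ σ, ?_, fun z φ hφ => ?_⟩
  · rw [Measure.variation_withDensityᵥ hσ, withDensity_apply _ .univ, Measure.restrict_univ]
    exact hσ.2
  · obtain ⟨C, -, hC⟩ := hφ.exists_bound
    have hF : IsCb1Field fun x => φ x • z := by
      simpa using isCb1Field_sum (Finset.univ : Finset (Fin 1)) (fun _ _ => hφ) fun _ => z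
    rw [integral_component_withDensity hσ z hφ.continuous.stronglyMeasurable hC]
    have h := hrep _ _ hF (hv.isMStar_smul hφ z)
    simp_rw [inner_smul_right] at h
    rw [← h, ← integral_neg]
    congr with x
    rw [inner_map_gradient, mstar]
    ring

end Existence

end HilbertBV

end

theorem mainTheorem2 {X : Type*} [NormedAddCommGroup X] [InnerProductSpace ℝ X] [CompleteSpace X]
    [TopologicalSpace.SeparableSpace X] [MeasurableSpace X] [BorelSpace X]
    (ν : Measure X) [IsProbabilityMeasure ν]
    (R : X →L[ℝ] X) (v : X → X → ℝ) (hv : HilbertBV.IsIBPFamily ν R v)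
    (p : ℝ≥0∞) (hp : 1 < p) (u : X → ℝ) (hu : MemLp u p ν) :
    (HilbertBV.MemBV ν R v u ↔ HilbertBV.V ν R u < ⊤) ∧
    (∀ m : VectorMeasure X X, HilbertBV.IsBVMeasure ν R v u m →
      ((m.variation Set.univ : ℝ≥0∞) : EReal) = HilbertBV.V ν R u) := by
  obtain ⟨r, hr, hur⟩ := HilbertBV.exists_real_exponent hp hu
  refine ⟨⟨?_, fun hV => ⟨hu.integrable hp.le, fun z => ?_, hv.exists_isBVMeasure hr hur hV⟩⟩,
    fun m hm => hm.variation_eq_V hv hr hur⟩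
  · rintro ⟨-, -, m, hm⟩
    rw [← hm.variation_eq_V hv hr hur]
    rw [← EReal.coe_ennreal_top, EReal.coe_ennreal_lt_coe_ennreal_iff]
    exact hm.1
  · have hrs := Real.HolderConjugate.conjExponent hr
    have := hrs.ennrealOfReal
    exact hur.integrable_mul ((hv z).1 _ hrs.symm.lt)
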